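/- Let $\mathcal X$ be a measurable space, $\mathcal Y\subset\mathbb R$ closed, and let $L:(\mathcal X\times\mathcal Y)^2\times\mathbb R\to[0,\infty)$ be a measurable function (a pairwise loss) that is convex in its last argument and Lipschitz continuous in its last argument with a constant independent of the other arguments. Let $L^*(x,y,x',y',t):=L(x,y,x',y',t)-L(x,y,x',y',0)$ be the shifted loss. For a measure $\mathrm P$ on $\mathcal X\times\mathcal Y$ and measurable $f:\mathcal X^2\to\mathbb R$ write $\mathcal R_{L^*,\mathrm P}(f):=\int L^*(x,y,x',y',f(x,x'))\,d\mathrm P^2(x,y,x',y')$, where $\mathrm P^2=\mathrm P\otimes\mathrm P$, and let the Bayes risk $\mathcal R^*_{L^*,\mathrm P}\in[-\infty,0]$ be the infimum of $\mathcal R_{L^*,\mathrm P}(f)$ over all measurable $f:\mathcal X^2\to\mathbb R$ for which this integral exists in $[-\infty,\infty]$. Let $H$ be the separable reproducing kernel Hilbert space of a bounded measurable kernel $k:\mathcal X^2\times\mathcal X^2\to\mathbb R$, and suppose that $H$ is dense in $L_1(\mathcal X^2,\mu)$ for every probability measure $\mu$ on $\mathcal X^2$. Let $(\lambda_n)\subset(0,\infty)$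 with $\lambda_n\to0$. For data $D_n=(z_1,\dots,z_n)\in(\mathcal X\times\mathcal Y)^n$, $n\ge1$, let $\mathrm D_n:=\frac1n\sum_{i=1}^n\delta_{z_i}$ be the empirical measure. Then there is a unique $f_{L^*,\mathrm D_n,\lambda_n}\in H$ minimizing $f\mapsto\mathcal R_{L^*,\mathrm D_n}(f)+\lambda_n\|f\|_H^2$ over $H$. Moreover, for every probability measure $\mathrm P$ on $\mathcal X\times\mathcal Y$, if $Z_1,Z_2,\dots$ are i.i.d. with distribution $\mathrm P$ and $\mathrm D_n$ is the empirical measure of $(Z_1,\dots,Z_n)$, the following hold. (i) If $\lambda_n^2n\to\infty$, then $\mathcal R_{L^*,\mathrm P}(f_{L^*,\mathrm D_n,\lambda_n})\to\mathcal R^*_{L^*,\mathrm P}$ in probability as $n\to\infty$. (ii) If $\lambda_n^{2+\delta}n\to\infty$ for some $\delta>0$, then $\mathcal R_{L^*,\mathrm P}(f_{L^*,\mathrm D_n,\lambda_n})\to\mathcal R^*_{L^*,\mathrm P}$ almost surely. If $\mathcal R^*_{L^*,\mathrm P}=-\infty$, convergence is understood in $[-\infty,\infty]$; convergence in probability to $c$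 means that the probability of lying outside any fixed neighbourhood of $c$ tends to $0$. -/

import Mathlib

open MeasureTheory ProbabilityTheory Filter Topology
open scoped ENNReal NNReal

noncomputable section

namespace PairwiseLearning

/-- A pairwise loss function `L : (X × Y)² × ℝ → [0, ∞)`, i.e. a nonnegative measurable function. -/
structure IsPairwiseLoss {X : Type*} [MeasurableSpace X] {Y : Set ℝ}
    (L : (X × Y) × (X × Y) → ℝ → ℝ) : Prop where
  measurable : Measurable (Function.uncurry L)
  nonneg : ∀ z t, 0 ≤ L z t

/-- Convexity of a pairwise loss in its last argument. -/
def IsConvexLoss {X : Type*} {Y : Set ℝ} (L : (X × Y) × (X × Y) → ℝ → ℝ) : Prop :=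
  ∀ z, ConvexOn ℝ Set.univ (L z)

/-- Lipschitz continuity of a pairwise loss in its last argument, uniformly in the others. -/
def IsLipschitzLoss {X : Type*} {Y : Set ℝ} (L : (X × Y) × (X × Y) → ℝ → ℝ) : Prop :=
  ∃ C : ℝ≥0, ∀ z, LipschitzWith C (L z)

/-- The shifted loss `L*(x,y,x',y',t) = L(x,y,x',y',t) - L(x,y,x',y',0)`. -/
def shiftedLoss {X : Type*} {Y : Set ℝ} (L : (X × Y) × (X × Y) → ℝ → ℝ) :
    (X × Y) × (X × Y) → ℝ → ℝ :=
  fun z t => L z t - L z 0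

/-- `∫ max(ℓ(x,y,x',y',f(x,x')), 0) dP²`, the positive part of the risk of `f`. -/
def riskPos {X : Type*} [MeasurableSpace X] {Y : Set ℝ} (l : (X × Y) × (X × Y) → ℝ → ℝ)
    (P : Measure (X × Y)) (f : X × X → ℝ) : ℝ≥0∞ :=
  ∫⁻ z, ENNReal.ofReal (l z (f (z.1.1, z.2.1))) ∂(P.prod P)

/-- `∫ max(-ℓ(x,y,x',y',f(x,x')), 0) dP²`, the negative part of the risk of `f`. -/
def riskNeg {X : Type*} [MeasurableSpace X] {Y : Set ℝ} (l : (X × Y) × (X × Y) → ℝ → ℝ)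
    (P : Measure (X × Y)) (f : X × X → ℝ) : ℝ≥0∞ :=
  ∫⁻ z, ENNReal.ofReal (-(l z (f (z.1.1, z.2.1)))) ∂(P.prod P)

/-- The risk integral `∫ ℓ(x,y,x',y',f(x,x')) dP²` exists in `[-∞, ∞]`, i.e. it is not of the
form `∞ - ∞`. -/
def RiskExists {X : Type*} [MeasurableSpace X] {Y : Set ℝ} (l : (X × Y) × (X × Y) → ℝ → ℝ)
    (P : Measure (X × Y)) (f : X × X → ℝ) : Prop :=
  riskPos l P f ≠ ∞ ∨ riskNeg l P f ≠ ∞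

/-- The risk `∫ ℓ(x,y,x',y',f(x,x')) dP²` with values in `[-∞, ∞]` (meaningful if `RiskExists`). -/
def risk {X : Type*} [MeasurableSpace X] {Y : Set ℝ} (l : (X × Y) × (X × Y) → ℝ → ℝ)
    (P : Measure (X × Y)) (f : X × X → ℝ) : EReal :=
  (riskPos l P f : EReal) - (riskNeg l P f : EReal)

/-- The Bayes risk: the infimum of the risk over all measurable `f : X² → ℝ` whose risk integral
exists in `[-∞, ∞]`. -/
def bayesRisk {X : Type*} [MeasurableSpace X] {Y : Set ℝ} (l : (X × Y) × (X × Y) → ℝ → ℝ)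
    (P : Measure (X × Y)) : EReal :=
  sInf {r : EReal | ∃ f : X × X → ℝ, Measurable f ∧ RiskExists l P f ∧ r = risk l P f}

/-- The real-valued kernel of an RKHS of real functions on `X²`. -/
def realKernel {X : Type*} (H : Type*) [NormedAddCommGroup H] [InnerProductSpace ℝ H]
    [CompleteSpace H] [RKHS ℝ H (X × X) ℝ] (u v : X × X) : ℝ :=
  RKHS.kernel H u v 1

/-- The kernel of the RKHS is bounded: `sup √k(u,u) < ∞`. -/
def HasBoundedKernel {X : Type*} (H : Type*) [NormedAddCommGroup H] [InnerProductSpace ℝ H]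
    [CompleteSpace H] [RKHS ℝ H (X × X) ℝ] : Prop :=
  BddAbove (Set.range fun u : X × X => √(realKernel H u u))

/-- The kernel of the RKHS is measurable as a function on `X² × X²`. -/
def HasMeasurableKernel {X : Type*} [MeasurableSpace X] (H : Type*) [NormedAddCommGroup H]
    [InnerProductSpace ℝ H] [CompleteSpace H] [RKHS ℝ H (X × X) ℝ] : Prop :=
  Measurable (Function.uncurry fun u v : X × X => realKernel H u v)

/-- `H` is dense in `L₁(X², ν)` for every probability measure `ν` on `X²`. -/
def IsDenseInAllL1 {X : Type*} [MeasurableSpace X] (H : Type*) [NormedAddCommGroup H]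
    [InnerProductSpace ℝ H] [RKHS ℝ H (X × X) ℝ] : Prop :=
  ∀ ν : Measure (X × X), IsProbabilityMeasure ν →
    (∀ f : H, Integrable (⇑f) ν) ∧
    ∀ g : X × X → ℝ, Integrable g ν → ∀ ε : ℝ, 0 < ε → ∃ f : H, ∫ u, |f u - g u| ∂ν < ε

/-- The regularized risk `R_{ℓ,P}(f) + c ‖f‖²` of `f` in the RKHS `H`. -/
def regRisk {X : Type*} [MeasurableSpace X] {Y : Set ℝ} {H : Type*} [NormedAddCommGroup H]
    [InnerProductSpace ℝ H] [RKHS ℝ H (X × X) ℝ] (l : (X × Y) × (X × Y) → ℝ → ℝ)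
    (P : Measure (X × Y)) (c : ℝ) (f : H) : EReal :=
  risk l P f + ((c * ‖f‖ ^ 2 : ℝ) : EReal)

/-- `f ∈ H` minimizes the regularized risk over `H`. -/
def IsRegMinimizer {X : Type*} [MeasurableSpace X] {Y : Set ℝ} {H : Type*} [NormedAddCommGroup H]
    [InnerProductSpace ℝ H] [RKHS ℝ H (X × X) ℝ] (l : (X × Y) × (X × Y) → ℝ → ℝ)
    (P : Measure (X × Y)) (c : ℝ) (f : H) : Prop :=
  ∀ g : H, regRisk l P c f ≤ regRisk l P c g

/-- The minimizer `f_{ℓ,P,c}` of the regularized risk over `H` (arbitrary if there is none). -/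
def regMinimizer {X : Type*} [MeasurableSpace X] {Y : Set ℝ} (H : Type*) [NormedAddCommGroup H]
    [InnerProductSpace ℝ H] [RKHS ℝ H (X × X) ℝ] (l : (X × Y) × (X × Y) → ℝ → ℝ)
    (P : Measure (X × Y)) (c : ℝ) : H :=
  Classical.epsilon fun f : H => IsRegMinimizer l P c f

/-- The empirical measure `n⁻¹ ∑_{i<n} δ_{D i}` of the first `n` data points. -/
def empiricalMeasure {Z : Type*} [MeasurableSpace Z] (D : ℕ → Z) (n : ℕ) : Measure Z :=
  (n : ℝ≥0∞)⁻¹ • ∑ i ∈ Finset.range n, Measure.dirac (D i)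

/-- Convergence in probability of `[-∞, ∞]`-valued quantities to a constant `c ∈ [-∞, ∞]`:
the probability of being outside any given neighbourhood of `c` tends to zero. -/
def ConvergesInProbability {Ω : Type*} [MeasurableSpace Ω] (μ : Measure Ω) (R : ℕ → Ω → EReal)
    (c : EReal) : Prop :=
  ∀ U ∈ 𝓝 c, Tendsto (fun n => μ {ω | R n ω ∉ U}) atTop (𝓝 0)

end PairwiseLearning

end

/-!
The proof combines algorithmic stability with the bounded differences inequality. No population
minimizer, subgradient or representer theorem is needed.

Writing `ψ z f = L*(z, f(x, x'))`, boundedness of the kernel makes `ψ z` a convex, `K`-Lipschitz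
function on the Hilbert space `H` with `ψ z 0 = 0` (`IsPairLoss`), and most of the argument takes
place for such a `ψ`. By the parallelogram law, a convex Lipschitz function plus `c ‖·‖²` has a
unique minimizer around which it grows quadratically (`exists_regularized_min`). Since replacing
one of `n` observations touches only `2 n` of the `n²` pairs, the empirical minimizer `f_D` then
moves by at most `4 K / (n c)` (`IsErm.norm_sub_le`). This has two consequences.

* Exchanging two training observations with two fresh ones shows that the expected population risk
  of `f_D` exceeds its expected empirical risk by at most `O(K² / (n c))`
  (`IsPairLoss.abs_integral_popRisk_sub_empRisk_le`). As `f_D` minimizes the regularized empirical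
  risk, `E R_P(f_D) ≤ R_P(g) + c ‖g‖² + O(1 / (n c))` for each fixed `g` in `H`.
* `D ↦ R_P(f_D)` has differences bounded by `4 K² / (n c)`, so McDiarmid's inequality
  (`hasSubgaussianMGF_of_bounded_differences`) bounds the probability that it exceeds its mean by
  `ε` by `exp (-a c² n)`, where `a > 0` depends on `ε` and `K` only.

Truncation and density of `H` in `L₁` show that the Bayes risk is the infimum of the risk over `H`,
also when it is `-∞` (`IsPairLoss.exists_popRisk_lt`). Hence, for each level `c` above the Bayes
risk, the risk of `f_D` reaches `c` only with probability at most `exp (-a λₙ² n)`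
(`IsPairLoss.exists_measure_risk_ge_le`). This tends to zero if `λₙ² n → ∞`, and it is summable if
`λₙ^(2+δ) n → ∞`, in which case the Borel–Cantelli lemma applies. From below, the risk of `f_D` is
bounded by the Bayes risk by definition.
-/

namespace PairwiseLearning

/-! ### Regularized minimization in a Hilbert space -/


lemma regularized_midpoint_le {H : Type*} [NormedAddCommGroup H] [InnerProductSpace ℝ H]
    {J : H → ℝ} (hJ : ConvexOn ℝ Set.univ J) (c : ℝ) (f g : H) :
    J ((2⁻¹ : ℝ) • (f + g)) + c * ‖(2⁻¹ : ℝ) • (f + g)‖ ^ 2 + c / 4 * ‖f - g‖ ^ 2 ≤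
      ((J f + c * ‖f‖ ^ 2) + (J g + c * ‖g‖ ^ 2)) / 2 := by
  have h1 : J ((2⁻¹ : ℝ) • f + (2⁻¹ : ℝ) • g) ≤ (2⁻¹ : ℝ) • J f + (2⁻¹ : ℝ) • J g :=
    hJ.2 (Set.mem_univ f) (Set.mem_univ g) (by norm_num) (by norm_num) (by norm_num)
  rw [← smul_add] at h1
  have h2 := parallelogram_law_with_norm ℝ f g
  rw [norm_smul, Real.norm_of_nonneg (by norm_num : (0 : ℝ) ≤ 2⁻¹)]
  simp only [smul_eq_mul] at h1
  have h3 : c * (2⁻¹ * ‖f + g‖) ^ 2 + c / 4 * ‖f - g‖ ^ 2 = (c * ‖f‖ ^ 2 + c * ‖g‖ ^ 2) / 2 := by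
    linear_combination (c / 4) * h2
  linarith

lemma bddBelow_regularized {H : Type*} [NormedAddCommGroup H] {J : H → ℝ} {K : ℝ}
    (hK : ∀ f g, |J f - J g| ≤ K * ‖f - g‖) {c : ℝ} (hc : 0 < c) :
    BddBelow (Set.range fun f => J f + c * ‖f‖ ^ 2) := by
  refine ⟨J 0 - K ^ 2 / (4 * c), ?_⟩
  rintro _ ⟨f, rfl⟩
  have h1 := (abs_le.1 (hK f 0)).1
  rw [sub_zero] at h1
  have h2 : 0 ≤ c * (‖f‖ - K / (2 * c)) ^ 2 := by positivity
  have h3 : c * (‖f‖ - K / (2 * c)) ^ 2 = c * ‖f‖ ^ 2 - K * ‖f‖ + K ^ 2 / (4 * c) := by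
    field_simp
    ring
  simp only
  linarith

lemma continuous_of_abs_sub_le {H : Type*} [NormedAddCommGroup H] {J : H → ℝ} {K : ℝ}
    (hK : ∀ f g, |J f - J g| ≤ K * ‖f - g‖) : Continuous J := by
  refine (LipschitzWith.of_dist_le_mul (K := K.toNNReal) fun f g => ?_).continuous
  rw [Real.dist_eq, dist_eq_norm]
  exact (hK f g).trans (mul_le_mul_of_nonneg_right (Real.le_coe_toNNReal K) (norm_nonneg _))

/-- A convex Lipschitz function plus `c ‖·‖²` has a minimizer, around which it grows at least
quadratically. Minimizing sequences are Cauchy by the parallelogram law, so that no weak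
compactness is needed. -/
theorem exists_regularized_min {H : Type*} [NormedAddCommGroup H] [InnerProductSpace ℝ H]
    [CompleteSpace H] {J : H → ℝ} (hJ : ConvexOn ℝ Set.univ J) {K : ℝ}
    (hK : ∀ f g, |J f - J g| ≤ K * ‖f - g‖) {c : ℝ} (hc : 0 < c) :
    ∃ f, ∀ g, J f + c * ‖f‖ ^ 2 + c / 2 * ‖g - f‖ ^ 2 ≤ J g + c * ‖g‖ ^ 2 := by
  set G : H → ℝ := fun f => J f + c * ‖f‖ ^ 2 with hG
  have hbdd : BddBelow (Set.range G) := bddBelow_regularized hK hc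
  have hm : ∀ f, ⨅ g, G g ≤ G f := fun f => ciInf_le hbdd f
  have hmid : ∀ f g, (⨅ h, G h) + c / 4 * ‖f - g‖ ^ 2 ≤ (G f + G g) / 2 := fun f g =>
    le_trans (by gcongr; exact hm _) (regularized_midpoint_le hJ c f g)
  have hex : ∀ n : ℕ, ∃ f, G f < (⨅ g, G g) + 1 / ((n : ℝ) + 1) := fun n =>
    exists_lt_of_ciInf_lt (lt_add_of_pos_right _ (by positivity))
  choose u hu using hex
  have hlim : Tendsto (fun N : ℕ => √(4 / c * (1 / ((N : ℝ) + 1)))) atTop (𝓝 0) := by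
    have := ((tendsto_one_div_add_atTop_nhds_zero_nat (𝕜 := ℝ)).const_mul (4 / c)).sqrt
    simpa using this
  have hcau : CauchySeq u := by
    refine cauchySeq_of_le_tendsto_0 _ (fun p q N hp hq => ?_) hlim
    rw [dist_eq_norm]
    refine Real.le_sqrt_of_sq_le ?_
    have h1 := hmid (u p) (u q)
    have h2 : ∀ r : ℕ, N ≤ r → G (u r) ≤ (⨅ g, G g) + 1 / ((N : ℝ) + 1) := fun r hr =>
      (hu r).le.trans (by gcongr)
    have h3 := h2 p hp
    have h4 := h2 q hq
    rw [div_mul_eq_mul_div, le_div_iff₀ hc]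
    linarith
  obtain ⟨f, hf⟩ := cauchySeq_tendsto_of_complete hcau
  have hcont : Continuous G := (continuous_of_abs_sub_le hK).add (by fun_prop)
  have hfm : G f ≤ ⨅ g, G g := by
    have h1 : Tendsto (fun n => G (u n)) atTop (𝓝 (G f)) := (hcont.tendsto f).comp hf
    have h2 : Tendsto (fun n : ℕ => (⨅ g, G g) + 1 / ((n : ℝ) + 1)) atTop (𝓝 ((⨅ g, G g) + 0)) :=
      tendsto_const_nhds.add tendsto_one_div_add_atTop_nhds_zero_nat
    rw [add_zero] at h2
    exact le_of_tendsto_of_tendsto' h1 h2 fun n => (hu n).le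
  refine ⟨f, fun g => ?_⟩
  have h1 := hmid g f
  change G f + c / 2 * ‖g - f‖ ^ 2 ≤ G g
  linarith

/-! ### Pairwise losses on a Hilbert space and empirical minimizers -/

/-- A pairwise loss read as a function `ψ z f` of the pair `z` of observations and of the
predictor `f`, an element of a Hilbert space: measurable in `z`, convex and `K`-Lipschitz in `f`,
and shifted so that `ψ z 0 = 0`. -/
structure IsPairLoss {Z H : Type*} [MeasurableSpace Z] [NormedAddCommGroup H]
    [InnerProductSpace ℝ H] (ψ : Z × Z → H → ℝ) (K : ℝ) : Prop where
  measurable : ∀ f, Measurable fun z => ψ z f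
  convex : ∀ z, ConvexOn ℝ Set.univ (ψ z)
  lip : ∀ z f g, |ψ z f - ψ z g| ≤ K * ‖f - g‖
  zero : ∀ z, ψ z 0 = 0
  nonneg : 0 ≤ K

/-- The empirical risk `n⁻² ∑ᵢ ∑ⱼ ψ (Dᵢ, Dⱼ) f`, the diagonal `i = j` included. -/
noncomputable def empRisk {Z H : Type*} (ψ : Z × Z → H → ℝ) {n : ℕ} (D : Fin n → Z) (f : H) : ℝ :=
  ((n : ℝ) ^ 2)⁻¹ * ∑ i, ∑ j, ψ (D i, D j) f

/-- The population risk `∫ ψ z f dP²`. -/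
noncomputable def popRisk {Z H : Type*} [MeasurableSpace Z] (ψ : Z × Z → H → ℝ) (P : Measure Z)
    (f : H) : ℝ :=
  ∫ z, ψ z f ∂(P.prod P)

/-- `f` minimizes `empRisk ψ D + c ‖·‖²`, with at least quadratic growth around it. -/
def IsErm {Z H : Type*} [NormedAddCommGroup H] (ψ : Z × Z → H → ℝ) (c : ℝ) {n : ℕ}
    (D : Fin n → Z) (f : H) : Prop :=
  ∀ g, empRisk ψ D f + c * ‖f‖ ^ 2 + c / 2 * ‖g - f‖ ^ 2 ≤ empRisk ψ D g + c * ‖g‖ ^ 2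

lemma IsErm.eq_of_le {Z H : Type*} [NormedAddCommGroup H] {ψ : Z × Z → H → ℝ} {c : ℝ} (hc : 0 < c)
    {n : ℕ} {D : Fin n → Z} {f g : H} (hf : IsErm ψ c D f)
    (hg : empRisk ψ D g + c * ‖g‖ ^ 2 ≤ empRisk ψ D f + c * ‖f‖ ^ 2) : g = f := by
  have h1 := hf g
  have h2 : ‖g - f‖ ^ 2 ≤ 0 := by
    by_contra h
    push Not at h
    have : 0 < c / 2 * ‖g - f‖ ^ 2 := by positivity
    linarith
  have h3 : ‖g - f‖ = 0 := by
    have := sq_nonneg ‖g - f‖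
    exact pow_eq_zero_iff (two_ne_zero) |>.1 (le_antisymm h2 this)
  exact sub_eq_zero.1 (norm_eq_zero.1 h3)

section Erm

variable {Z H : Type*} [MeasurableSpace Z] [NormedAddCommGroup H] [InnerProductSpace ℝ H]
  {ψ : Z × Z → H → ℝ} {K : ℝ} {n : ℕ}

lemma IsPairLoss.abs_apply_le (hψ : IsPairLoss ψ K) (z : Z × Z) (f : H) : |ψ z f| ≤ K * ‖f‖ := by
  simpa [hψ.zero] using hψ.lip z f 0

lemma IsPairLoss.empRisk_convexOn (hψ : IsPairLoss ψ K) (D : Fin n → Z) :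
    ConvexOn ℝ Set.univ (empRisk ψ D) := by
  have h : ConvexOn ℝ Set.univ (fun f => ∑ i, ∑ j, ψ (D i, D j) f) := by
    refine ⟨convex_univ, fun f _ g _ a b ha hb hab => ?_⟩
    simp only [smul_eq_mul, Finset.mul_sum, ← Finset.sum_add_distrib]
    exact Finset.sum_le_sum fun i _ => Finset.sum_le_sum fun j _ =>
      (hψ.convex _).2 (Set.mem_univ f) (Set.mem_univ g) ha hb hab
  exact h.smul (c := ((n : ℝ) ^ 2)⁻¹) (by positivity)

/-- If `D` and `D'` agree off `S`, at most `2 n |S|` of the `n²` pairs distinguish their empirical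
risks. -/
lemma IsPairLoss.empRisk_sub_le (hψ : IsPairLoss ψ K) {D D' : Fin n → Z} {S : Finset (Fin n)}
    (hS : ∀ i, i ∉ S → D i = D' i) (f g : H) :
    (empRisk ψ D g - empRisk ψ D' g) - (empRisk ψ D f - empRisk ψ D' f) ≤
      4 * K * S.card / n * ‖f - g‖ := by
  rcases Nat.eq_zero_or_pos n with rfl | hn
  · simp [empRisk]
  have hn' : (0 : ℝ) < n := by exact_mod_cast hn
  have key : ∀ i j, (ψ (D i, D j) g - ψ (D' i, D' j) g) - (ψ (D i, D j) f - ψ (D' i, D' j) f) ≤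
      (if i ∈ S then 2 * K * ‖f - g‖ else 0) + (if j ∈ S then 2 * K * ‖f - g‖ else 0) := by
    intro i j
    have hb : (ψ (D i, D j) g - ψ (D' i, D' j) g) - (ψ (D i, D j) f - ψ (D' i, D' j) f) ≤
        2 * K * ‖f - g‖ := by
      have h1 := abs_le.1 (hψ.lip (D i, D j) f g)
      have h2 := abs_le.1 (hψ.lip (D' i, D' j) f g)
      linarith [h1.1, h2.2]
    have hp : 0 ≤ 2 * K * ‖f - g‖ := by have := hψ.nonneg; positivity
    by_cases hi : i ∈ S <;> by_cases hj : j ∈ S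
    · simp only [hi, hj, if_true]; linarith
    · simp only [hi, hj, if_true, if_false]; linarith
    · simp only [hi, hj, if_true, if_false]; linarith
    · simp [hi, hj, hS i hi, hS j hj]
  have hsum : ∑ i, ∑ j, ((ψ (D i, D j) g - ψ (D' i, D' j) g) -
      (ψ (D i, D j) f - ψ (D' i, D' j) f)) ≤ 4 * K * S.card * n * ‖f - g‖ := by
    refine (Finset.sum_le_sum fun i _ => Finset.sum_le_sum fun j _ => key i j).trans_eq ?_
    simp only [Finset.sum_add_distrib, Finset.sum_const, Finset.card_univ, Fintype.card_fin,
      Finset.sum_ite_mem, Finset.univ_inter, nsmul_eq_mul, ← Finset.mul_sum]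
    ring
  simp only [Finset.sum_sub_distrib] at hsum
  have : (empRisk ψ D g - empRisk ψ D' g) - (empRisk ψ D f - empRisk ψ D' f) =
      ((n : ℝ) ^ 2)⁻¹ * ((∑ i, ∑ j, ψ (D i, D j) g - ∑ i, ∑ j, ψ (D' i, D' j) g) -
        (∑ i, ∑ j, ψ (D i, D j) f - ∑ i, ∑ j, ψ (D' i, D' j) f)) := by
    simp only [empRisk]; ring
  rw [this]
  refine (mul_le_mul_of_nonneg_left hsum (by positivity)).trans_eq ?_
  field_simp

lemma IsPairLoss.abs_empRisk_sub_le (hψ : IsPairLoss ψ K) (D : Fin n → Z) (f g : H) :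
    |empRisk ψ D f - empRisk ψ D g| ≤ K * ‖f - g‖ := by
  rcases Nat.eq_zero_or_pos n with rfl | hn
  · have := hψ.nonneg
    simp only [empRisk, Finset.univ_eq_empty, Finset.sum_empty, mul_zero, sub_zero, abs_zero]
    positivity
  have hn' : (0 : ℝ) < n := by exact_mod_cast hn
  simp only [empRisk, ← mul_sub, ← Finset.sum_sub_distrib]
  rw [abs_mul, abs_of_nonneg (by positivity), inv_mul_le_iff₀ (by positivity)]
  refine (Finset.abs_sum_le_sum_abs _ _).trans ?_
  refine (Finset.sum_le_sum fun i _ => (Finset.abs_sum_le_sum_abs _ _).trans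
    (Finset.sum_le_sum fun j _ => hψ.lip _ f g)).trans_eq ?_
  simp only [Finset.sum_const, Finset.card_univ, Fintype.card_fin, nsmul_eq_mul]
  ring

lemma IsPairLoss.empRisk_measurable (hψ : IsPairLoss ψ K) (f : H) :
    Measurable fun D : Fin n → Z => empRisk ψ D f := by
  refine Measurable.const_mul (Finset.measurable_fun_sum _ fun i _ =>
    Finset.measurable_fun_sum _ fun j _ => ?_) _
  exact (hψ.measurable f).comp ((measurable_pi_apply i).prodMk (measurable_pi_apply j))

lemma IsPairLoss.exists_isErm [CompleteSpace H] (hψ : IsPairLoss ψ K) {c : ℝ} (hc : 0 < c)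
    (D : Fin n → Z) : ∃ f, IsErm ψ c D f :=
  exists_regularized_min (hψ.empRisk_convexOn D) (hψ.abs_empRisk_sub_le D) hc

lemma IsErm.norm_le (hψ : IsPairLoss ψ K) {c : ℝ} (hc : 0 < c) {D : Fin n → Z} {f : H}
    (hf : IsErm ψ c D f) : ‖f‖ ≤ K / c := by
  have h1 := hf 0
  have h2 := (abs_le.1 (hψ.abs_empRisk_sub_le D f 0)).1
  rw [sub_zero] at h2
  have h4 : 0 ≤ c / 2 * ‖(0 : H) - f‖ ^ 2 := by positivity
  rw [norm_zero] at h1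
  have h5 : c * ‖f‖ ^ 2 ≤ K * ‖f‖ := by linarith
  rw [le_div_iff₀ hc]
  rcases (norm_nonneg f).eq_or_lt with h | h
  · rw [← h, zero_mul]; exact hψ.nonneg
  · nlinarith

/-- Algorithmic stability: changing `|S|` of the `n` observations moves the minimizer by at most
`4 K |S| / (n c)`. -/
lemma IsErm.norm_sub_le (hψ : IsPairLoss ψ K) {c : ℝ} (hc : 0 < c) {D D' : Fin n → Z} {f f' : H}
    (hf : IsErm ψ c D f) (hf' : IsErm ψ c D' f') {S : Finset (Fin n)}
    (hS : ∀ i, i ∉ S → D i = D' i) : ‖f - f'‖ ≤ 4 * K * S.card / (n * c) := by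
  have h1 := hf f'
  have h2 := hf' f
  have h3 := hψ.empRisk_sub_le hS f f'
  rw [norm_sub_rev f' f] at h1
  have h5 : c * ‖f - f'‖ ^ 2 ≤ 4 * K * S.card / n * ‖f - f'‖ := by linarith
  have hK := hψ.nonneg
  rw [← div_div, le_div_iff₀ hc]
  rcases (norm_nonneg (f - f')).eq_or_lt with h | h
  · rw [← h, zero_mul]; positivity
  · nlinarith

/-- The regularized empirical minimizer `f_{D,c}`. It is only used for `c > 0`, where it exists and
is unique; for other `c` the value is `0`. -/
noncomputable def erm [CompleteSpace H] (hψ : IsPairLoss ψ K) (c : ℝ) (D : Fin n → Z) : H :=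
  open Classical in if hc : 0 < c then (hψ.exists_isErm hc D).choose else 0

lemma isErm_erm [CompleteSpace H] (hψ : IsPairLoss ψ K) {c : ℝ} (hc : 0 < c) (D : Fin n → Z) :
    IsErm ψ c D (erm hψ c D) := by
  rw [erm, dif_pos hc]
  exact (hψ.exists_isErm hc D).choose_spec

/-- The empirical minimizer depends measurably on the data: it is the limit of the first
`1 / (m + 1)`-approximate minimizers along a fixed dense sequence. -/
lemma measurable_erm [CompleteSpace H] [TopologicalSpace.SeparableSpace H] [MeasurableSpace H]
    [BorelSpace H] (hψ : IsPairLoss ψ K) {c : ℝ} (hc : 0 < c) :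
    Measurable fun D : Fin n → Z => erm hψ c D := by
  classical
  set G : (Fin n → Z) → H → ℝ := fun D f => empRisk ψ D f + c * ‖f‖ ^ 2 with hG
  set e := TopologicalSpace.denseSeq H with he
  have hGm : ∀ f, Measurable fun D => G D f := fun f => (hψ.empRisk_measurable f).add_const _
  have hGc : ∀ D, Continuous (G D) := fun D =>
    (continuous_of_abs_sub_le (hψ.abs_empRisk_sub_le D)).add (by fun_prop)
  have hmin : ∀ D f, G D (erm hψ c D) + c / 2 * ‖f - erm hψ c D‖ ^ 2 ≤ G D f :=
    fun D f => isErm_erm hψ hc D f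
  have hle : ∀ D f, G D (erm hψ c D) ≤ G D f := fun D f =>
    le_trans (le_add_of_nonneg_right (by positivity)) (hmin D f)
  have happ : ∀ D {ε : ℝ}, 0 < ε → ∃ k, G D (e k) < G D (erm hψ c D) + ε := by
    intro D ε hε
    have hopen : IsOpen {f | G D f < G D (erm hψ c D) + ε} := isOpen_lt (hGc D) continuous_const
    obtain ⟨k, hk⟩ := (TopologicalSpace.denseRange_denseSeq H).exists_mem_open hopen
      ⟨erm hψ c D, by simpa using hε⟩
    exact ⟨k, hk⟩
  have hval : Measurable fun D => G D (erm hψ c D) := by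
    have heq : (fun D => G D (erm hψ c D)) = fun D => ⨅ k, G D (e k) := by
      funext D
      refine le_antisymm (le_ciInf fun k => hle D _) ?_
      refine le_of_forall_pos_le_add fun ε hε => ?_
      obtain ⟨k, hk⟩ := happ D hε
      exact (ciInf_le ⟨_, by rintro _ ⟨k, rfl⟩; exact hle D _⟩ k).trans hk.le
    rw [heq]
    exact Measurable.iInf fun k => hGm (e k)
  have hex : ∀ (m : ℕ) D, ∃ k, G D (e k) < G D (erm hψ c D) + 1 / ((m : ℝ) + 1) :=
    fun m D => happ D (by positivity)
  refine measurable_of_tendsto_metrizable (f := fun m D => e (Nat.find (hex m D))) (fun m => ?_) ?_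
  · exact (measurable_of_countable e).comp
      (measurable_find (hex m) fun k => measurableSet_lt (hGm _) (hval.add_const _))
  · rw [tendsto_pi_nhds]
    intro D
    rw [tendsto_iff_norm_sub_tendsto_zero]
    have hlim : Tendsto (fun m : ℕ => √(2 / c * (1 / ((m : ℝ) + 1)))) atTop (𝓝 0) := by
      have := ((tendsto_one_div_add_atTop_nhds_zero_nat (𝕜 := ℝ)).const_mul (2 / c)).sqrt
      simpa using this
    refine squeeze_zero (fun _ => norm_nonneg _) (fun m => ?_) hlim
    refine Real.le_sqrt_of_sq_le ?_
    have h1 := Nat.find_spec (hex m D)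
    have h2 := hmin D (e (Nat.find (hex m D)))
    rw [div_mul_eq_mul_div, le_div_iff₀ hc]
    linarith

end Erm

/-! ### The bounded differences inequality -/

/-- McDiarmid's bounded differences inequality, as a bound on the moment generating function. The
induction integrates out all but the first coordinate; that coordinate is handled by Hoeffding's
lemma. (The variance proxy `n b²` is four times the optimal one.) -/
theorem hasSubgaussianMGF_of_bounded_differences {Z : Type*} [MeasurableSpace Z] (P : Measure Z)
    [IsProbabilityMeasure P] {b : ℝ≥0} (n : ℕ) (F : (Fin n → Z) → ℝ) (hF : Measurable F) {M : ℝ}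
    (hM : ∀ D, |F D| ≤ M)
    (hb : ∀ D D' i, (∀ j, j ≠ i → D j = D' j) → |F D - F D'| ≤ b) :
    HasSubgaussianMGF (fun D => F D - ∫ D', F D' ∂(Measure.pi fun _ => P)) (n * b ^ 2)
      (Measure.pi fun _ : Fin n => P) := by
  induction n with
  | zero =>
    have hc : ∀ D D', F D = F D' := fun D D' => by rw [Subsingleton.elim D D']
    have : (fun D => F D - ∫ D', F D' ∂(Measure.pi fun _ => P)) = fun _ => 0 := by
      funext D
      simp [integral_congr_ae (Eventually.of_forall fun D' => hc D' D)]
    rw [this]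
    simp
  | succ n ih =>
    set Q := Measure.pi fun _ : Fin n => P
    have hmp := measurePreserving_piFinSuccAbove (fun _ : Fin (n + 1) => P) 0
    set e := MeasurableEquiv.piFinSuccAbove (fun _ : Fin (n + 1) => Z) 0
    -- `G z D` is `F` at the sequence with first entry `z` and tail `D`.
    set G : Z → (Fin n → Z) → ℝ := fun z D => F (e.symm (z, D)) with hG
    have hGe : ∀ D, F D = G (e D).1 (e D).2 := fun D => by simp [hG]
    have hGm : Measurable (Function.uncurry G) := hF.comp e.symm.measurable
    have hGm' : ∀ z, Measurable (G z) := fun z => hGm.comp measurable_prodMk_left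
    have hcons : ∀ z D, e.symm (z, D) = (Fin.cons z D : Fin (n + 1) → Z) := fun z D => by
      simp [e, MeasurableEquiv.piFinSuccAbove, Fin.insertNthEquiv]
    have hG0 : ∀ z z' D, |G z D - G z' D| ≤ b := fun z z' D => by
      refine hb _ _ 0 fun j hj => ?_
      rw [hcons, hcons]
      obtain ⟨k, rfl⟩ := Fin.exists_succ_eq.2 hj
      simp
    have hGs : ∀ z D D' i, (∀ j, j ≠ i → D j = D' j) → |G z D - G z D'| ≤ b :=
      fun z D D' i h => by
        refine hb _ _ i.succ fun j hj => ?_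
        rw [hcons, hcons]
        refine Fin.cases (fun _ => by simp) (fun k hk => ?_) j hj
        simpa using h k fun hki => hk (by rw [hki])
    have hGM : ∀ z D, |G z D| ≤ M := fun z D => hM _
    have hGi : ∀ z, Integrable (G z) Q := fun z =>
      Integrable.of_bound (hGm' z).aestronglyMeasurable M (Eventually.of_forall (hGM z))
    set m : Z → ℝ := fun z => ∫ D, G z D ∂Q with hm
    have hmm : Measurable m := (hGm.stronglyMeasurable.integral_prod_right (ν := Q)).measurable
    have hint : ∫ D', F D' ∂(Measure.pi fun _ => P) = ∫ z, m z ∂P := by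
      have hi : Integrable (Function.uncurry G) (P.prod Q) :=
        Integrable.of_bound hGm.aestronglyMeasurable M (Eventually.of_forall fun p => hGM _ _)
      have h1 := hmp.integral_comp e.measurableEmbedding (Function.uncurry G)
      simp only [Function.uncurry, ← hGe] at h1
      rw [h1]
      exact integral_prod _ hi
    have hmb : ∀ z z', |m z - m z'| ≤ b := fun z z' => by
      rw [hm]
      simp only
      rw [← integral_sub (hGi z) (hGi z'), ← Real.norm_eq_abs]
      refine (norm_integral_le_of_norm_le_const (C := b)
        (Eventually.of_forall fun D => hG0 z z' D)).trans ?_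
      simp
    obtain ⟨z₀⟩ := P.nonempty_of_neZero
    -- Any two values of `m` are at most `b` apart; an interval of length `2 b` around one of them
    -- contains all others, which avoids suprema.
    have hHoef : HasSubgaussianMGF (fun z => m z - P[m]) (b ^ 2) P := by
      have h := hasSubgaussianMGF_of_mem_Icc (μ := P) (X := m) (a := m z₀ - b) (b := m z₀ + b)
        hmm.aemeasurable (Eventually.of_forall fun z => by
          have := abs_le.1 (hmb z z₀)
          constructor <;> linarith [this.1, this.2])
      convert h using 2
      have : m z₀ + b - (m z₀ - b) = 2 * b := by ring
      rw [this]
      ext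
      simp
    have hih := fun z => ih (G z) (hGm' z) (hGM z) (hGs z)
    rw [hint]
    have hFb : ∀ D, |F D - ∫ z, m z ∂P| ≤ M + |∫ z, m z ∂P| := fun D =>
      (abs_sub _ _).trans (by gcongr; exact hM D)
    have hexp : ∀ t : ℝ, Integrable
        (fun D => Real.exp (t * (F D - ∫ z, m z ∂P))) (Measure.pi fun _ => P) := fun t =>
      integrable_exp_mul_of_mem_Icc (a := -(M + |∫ z, m z ∂P|)) (b := M + |∫ z, m z ∂P|)
        (hF.sub_const _).aemeasurable (Eventually.of_forall fun D => abs_le.1 (hFb D))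
    refine ⟨hexp, fun t => ?_⟩
    set E := ∫ z, m z ∂P
    have hprod : mgf (fun D => F D - E) (Measure.pi fun _ => P) t =
        ∫ z, Real.exp (t * (m z - E)) * mgf (fun D => G z D - m z) Q t ∂P := by
      have h1 := hmp.integral_comp e.measurableEmbedding
        (fun p : Z × (Fin n → Z) => Real.exp (t * (G p.1 p.2 - E)))
      have h2 : Integrable (fun p : Z × (Fin n → Z) => Real.exp (t * (G p.1 p.2 - E)))
          (P.prod Q) := by
        refine (hmp.integrable_comp_emb e.measurableEmbedding).1 ?_
        simpa [Function.comp_def, ← hGe] using hexp t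
      simp only [← hGe] at h1
      rw [mgf, h1, integral_prod _ h2]
      refine integral_congr_ae (Eventually.of_forall fun z => ?_)
      simp only [mgf]
      rw [← integral_const_mul]
      refine integral_congr_ae (Eventually.of_forall fun D => ?_)
      simp only
      rw [← Real.exp_add]
      congr 1
      ring
    rw [hprod]
    have hle : ∀ z, Real.exp (t * (m z - E)) * mgf (fun D => G z D - m z) Q t ≤
        Real.exp (t * (m z - E)) * Real.exp ((n * b ^ 2 : ℝ≥0) * t ^ 2 / 2) := fun z =>
      mul_le_mul_of_nonneg_left ((hih z).mgf_le t) (Real.exp_pos _).le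
    refine (integral_mono_of_nonneg (Eventually.of_forall fun z => mul_nonneg (Real.exp_pos _).le
      mgf_nonneg) ((hHoef.integrable_exp_mul t).mul_const _) (Eventually.of_forall hle)).trans ?_
    rw [integral_mul_const]
    refine (mul_le_mul_of_nonneg_right (hHoef.mgf_le t) (Real.exp_pos _).le).trans_eq ?_
    rw [← Real.exp_add]
    congr 1
    push_cast
    ring

/-! ### Generalization of the empirical minimizer -/

section Generalization

variable {Z H : Type*} [MeasurableSpace Z] [NormedAddCommGroup H] [InnerProductSpace ℝ H]
  {ψ : Z × Z → H → ℝ} {K : ℝ} {n : ℕ}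

lemma IsPairLoss.measurable_uncurry [TopologicalSpace.SeparableSpace H] [MeasurableSpace H]
    [BorelSpace H] (hψ : IsPairLoss ψ K) : Measurable fun p : (Z × Z) × H => ψ p.1 p.2 := by
  have : SecondCountableTopology H := UniformSpace.secondCountable_of_separable H
  exact (measurable_uncurry_of_continuous_of_measurable (u := fun (f : H) (z : Z × Z) => ψ z f)
    (fun z => continuous_of_abs_sub_le (hψ.lip z)) hψ.measurable).comp measurable_swap

lemma IsPairLoss.integrable (hψ : IsPairLoss ψ K) (μ : Measure (Z × Z)) [IsFiniteMeasure μ]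
    (f : H) : Integrable (fun z => ψ z f) μ :=
  Integrable.of_bound (hψ.measurable f).aestronglyMeasurable (K * ‖f‖)
    (Eventually.of_forall fun z => hψ.abs_apply_le z f)

lemma IsPairLoss.abs_popRisk_sub_le (hψ : IsPairLoss ψ K) (P : Measure Z)
    [IsProbabilityMeasure P] (f g : H) : |popRisk ψ P f - popRisk ψ P g| ≤ K * ‖f - g‖ := by
  rw [popRisk, popRisk, ← integral_sub (hψ.integrable _ f) (hψ.integrable _ g), ← Real.norm_eq_abs]
  refine (norm_integral_le_of_norm_le_const (C := K * ‖f - g‖)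
    (Eventually.of_forall fun z => hψ.lip z f g)).trans ?_
  simp

lemma IsPairLoss.abs_popRisk_le (hψ : IsPairLoss ψ K) (P : Measure Z) [IsProbabilityMeasure P]
    (f : H) : |popRisk ψ P f| ≤ K * ‖f‖ := by
  have := hψ.abs_popRisk_sub_le P f 0
  simpa [popRisk, hψ.zero] using this

/-- The first `n` of `n + 2` independent observations and the pair of the last two. -/
lemma measurePreserving_sample_pair (P : Measure Z) [IsProbabilityMeasure P] (n : ℕ) :
    MeasurePreserving
      (fun W : Fin n ⊕ Fin 2 → Z => ((fun i => W (.inl i)), (W (.inr 0), W (.inr 1))))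
      (Measure.pi fun _ => P) ((Measure.pi fun _ => P).prod (P.prod P)) :=
  ((MeasurePreserving.id _).prod (measurePreserving_finTwoArrow P)).comp
    (measurePreserving_sumPiEquivProdPi fun _ : Fin n ⊕ Fin 2 => P)

lemma integral_comp_perm {ι : Type*} [Fintype ι] (P : Measure Z) [IsProbabilityMeasure P]
    (σ : Equiv.Perm ι) (Φ : (ι → Z) → ℝ) :
    ∫ W, Φ (fun i => W (σ i)) ∂(Measure.pi fun _ => P) = ∫ W, Φ W ∂(Measure.pi fun _ => P) := by
  have hmp := (measurePreserving_piCongrLeft (fun _ : ι => P) σ).symm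
  rw [← hmp.integral_comp (MeasurableEquiv.measurableEmbedding _) Φ]
  rfl

lemma IsPairLoss.integrable_comp [TopologicalSpace.SeparableSpace H] [MeasurableSpace H]
    [BorelSpace H] (hψ : IsPairLoss ψ K) {Ω : Type*} [MeasurableSpace Ω] (μ : Measure Ω)
    [IsFiniteMeasure μ] {p : Ω → Z × Z} (hp : Measurable p) {T : Ω → H} (hT : Measurable T) {B : ℝ}
    (hB : ∀ D, ‖T D‖ ≤ B) : Integrable (fun ω => ψ (p ω) (T ω)) μ :=
  Integrable.of_bound (hψ.measurable_uncurry.comp (hp.prodMk hT)).aestronglyMeasurable (K * B)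
    (Eventually.of_forall fun ω => (hψ.abs_apply_le _ _).trans
      (mul_le_mul_of_nonneg_left (hB ω) hψ.nonneg))

/-- The loss on a fresh pair compared with the loss on the pair `(Dᵢ, Dⱼ)` of distinct training
observations: exchanging both pairs does not alter the joint law, and alters the predictor `T D`
by at most `η`. -/
lemma IsPairLoss.abs_integral_popRisk_sub_le [TopologicalSpace.SeparableSpace H]
    [MeasurableSpace H] [BorelSpace H] (hψ : IsPairLoss ψ K) (P : Measure Z)
    [IsProbabilityMeasure P] {T : (Fin n → Z) → H} (hT : Measurable T) {B : ℝ}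
    (hB : ∀ D, ‖T D‖ ≤ B) {i j : Fin n} (hij : i ≠ j) {η : ℝ}
    (hη : ∀ D D', (∀ k, k ∉ ({i, j} : Finset (Fin n)) → D k = D' k) → ‖T D - T D'‖ ≤ η) :
    |∫ D, popRisk ψ P (T D) ∂(Measure.pi fun _ => P) -
      ∫ D, ψ (D i, D j) (T D) ∂(Measure.pi fun _ => P)| ≤ K * η := by
  set Q := Measure.pi fun _ : Fin n => P
  set ν := Measure.pi fun _ : Fin n ⊕ Fin 2 => P
  have hmp := measurePreserving_sample_pair P n
  have hTm : Measurable fun W : Fin n ⊕ Fin 2 → Z => T fun k => W (.inl k) :=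
    hT.comp (measurable_pi_lambda _ fun k => measurable_pi_apply _)
  have h1 : ∫ D, popRisk ψ P (T D) ∂Q =
      ∫ W, ψ (W (.inr 0), W (.inr 1)) (T fun k => W (.inl k)) ∂ν := by
    have hi : Integrable (fun p : (Fin n → Z) × (Z × Z) => ψ p.2 (T p.1)) (Q.prod (P.prod P)) :=
      hψ.integrable_comp _ measurable_snd (hT.comp measurable_fst) fun p => hB p.1
    rw [show (fun D => popRisk ψ P (T D)) = fun D => ∫ z, ψ z (T D) ∂(P.prod P) from rfl,
      ← integral_prod _ hi, ← hmp.map_eq, integral_map hmp.aemeasurable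
        (hmp.map_eq ▸ hi.aestronglyMeasurable)]
  have h2 : ∫ D, ψ (D i, D j) (T D) ∂Q =
      ∫ W, ψ (W (.inl i), W (.inl j)) (T fun k => W (.inl k)) ∂ν := by
    have hmp' : MeasurePreserving (fun (W : Fin n ⊕ Fin 2 → Z) k => W (.inl k)) ν Q :=
      measurePreserving_fst.comp hmp
    have hi : Integrable (fun D : Fin n → Z => ψ (D i, D j) (T D)) Q :=
      hψ.integrable_comp _ ((measurable_pi_apply i).prodMk (measurable_pi_apply j)) hT hB
    rw [← hmp'.map_eq, integral_map hmp'.aemeasurable (hmp'.map_eq ▸ hi.aestronglyMeasurable)]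
  -- `σ` exchanges the training observations `i`, `j` with the fresh pair.
  let σ : Equiv.Perm (Fin n ⊕ Fin 2) :=
    Equiv.swap (.inl i) (.inr 0) * Equiv.swap (.inl j) (.inr 1)
  have hσ0 : σ (.inr 0) = .inl i := by
    simp [σ, Equiv.swap_apply_of_ne_of_ne]
  have hσ1 : σ (.inr 1) = .inl j := by
    simp [σ, Equiv.swap_apply_of_ne_of_ne, hij.symm]
  have hσk : ∀ k, k ∉ ({i, j} : Finset (Fin n)) → σ (.inl k) = .inl k := by
    intro k hk
    simp only [Finset.mem_insert, Finset.mem_singleton, not_or] at hk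
    simp [σ, Equiv.swap_apply_of_ne_of_ne, hk.1, hk.2]
  have h3 := integral_comp_perm P σ fun W : Fin n ⊕ Fin 2 → Z =>
    ψ (W (.inr 0), W (.inr 1)) (T fun k => W (.inl k))
  simp only [hσ0, hσ1] at h3
  rw [h1, h2, ← h3, ← integral_sub, ← Real.norm_eq_abs]
  · refine (norm_integral_le_of_norm_le_const (C := K * η)
      (Eventually.of_forall fun W => ?_)).trans (by simp)
    refine (hψ.lip _ _ _).trans (mul_le_mul_of_nonneg_left (hη _ _ fun k hk => ?_) hψ.nonneg)
    rw [hσk k hk]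
  · exact hψ.integrable_comp _ ((measurable_pi_apply _).prodMk (measurable_pi_apply _))
      (hT.comp (measurable_pi_lambda _ fun k => measurable_pi_apply _)) fun W => hB _
  · exact hψ.integrable_comp _ ((measurable_pi_apply _).prodMk (measurable_pi_apply _))
      hTm fun W => hB _

/-- Expected generalization gap of a stable learning method `T`. The term `2 K B / n` accounts for
the `n` diagonal pairs among the `n²` pairs of the empirical risk. -/
lemma IsPairLoss.abs_integral_popRisk_sub_empRisk_le [TopologicalSpace.SeparableSpace H]
    [MeasurableSpace H] [BorelSpace H] (hψ : IsPairLoss ψ K) (P : Measure Z)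
    [IsProbabilityMeasure P] (hn : 0 < n) {T : (Fin n → Z) → H} (hT : Measurable T) {B : ℝ}
    (hB : ∀ D, ‖T D‖ ≤ B) {η : ℝ} (hη0 : 0 ≤ η)
    (hη : ∀ (S : Finset (Fin n)) D D', S.card ≤ 2 → (∀ k, k ∉ S → D k = D' k) →
      ‖T D - T D'‖ ≤ η) :
    |∫ D, popRisk ψ P (T D) ∂(Measure.pi fun _ => P) -
      ∫ D, empRisk ψ D (T D) ∂(Measure.pi fun _ => P)| ≤ K * η + 2 * K * B / n := by
  set Q := Measure.pi fun _ : Fin n => P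
  have hn' : (0 : ℝ) < n := by exact_mod_cast hn
  have hK := hψ.nonneg
  have hi : ∀ i j, Integrable (fun D : Fin n → Z => ψ (D i, D j) (T D)) Q := fun i j =>
    hψ.integrable_comp _ ((measurable_pi_apply i).prodMk (measurable_pi_apply j)) hT hB
  set a := ∫ D, popRisk ψ P (T D) ∂Q
  have hemp : ∫ D, empRisk ψ D (T D) ∂Q =
      ((n : ℝ) ^ 2)⁻¹ * ∑ i, ∑ j, ∫ D, ψ (D i, D j) (T D) ∂Q := by
    simp only [empRisk]
    rw [integral_const_mul, integral_finsetSum _ fun i _ => integrable_finsetSum _ fun j _ =>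
      hi i j]
    simp_rw [integral_finsetSum _ fun j _ => hi _ j]
  have hbd : ∀ i j, |a - ∫ D, ψ (D i, D j) (T D) ∂Q| ≤
      K * η + if i = j then 2 * K * B else 0 := by
    intro i j
    split_ifs with h
    · have h1 : ∀ D, |popRisk ψ P (T D)| ≤ K * B := fun D =>
        (hψ.abs_popRisk_le P _).trans (mul_le_mul_of_nonneg_left (hB D) hK)
      have h2 : ∀ D : Fin n → Z, |ψ (D i, D j) (T D)| ≤ K * B := fun D =>
        (hψ.abs_apply_le _ _).trans (mul_le_mul_of_nonneg_left (hB D) hK)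
      have h3 : ‖a‖ ≤ K * B := by
        simpa using norm_integral_le_of_norm_le_const (μ := Q)
          (f := fun D => popRisk ψ P (T D)) (Eventually.of_forall h1)
      have h4 : ‖∫ D, ψ (D i, D j) (T D) ∂Q‖ ≤ K * B := by
        simpa using norm_integral_le_of_norm_le_const (μ := Q)
          (f := fun D => ψ (D i, D j) (T D)) (Eventually.of_forall h2)
      have h5 := norm_sub_le a (∫ D, ψ (D i, D j) (T D) ∂Q)
      rw [← Real.norm_eq_abs]
      have : 0 ≤ K * η := by positivity
      linarith
    · rw [add_zero]
      exact hψ.abs_integral_popRisk_sub_le P hT hB h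
        fun D D' hD => hη {i, j} D D' Finset.card_le_two hD
  have hdiff : a - ∫ D, empRisk ψ D (T D) ∂Q =
      ((n : ℝ) ^ 2)⁻¹ * ∑ i, ∑ j, (a - ∫ D, ψ (D i, D j) (T D) ∂Q) := by
    rw [hemp]
    simp only [Finset.sum_sub_distrib, Finset.sum_const, Finset.card_univ, Fintype.card_fin,
      nsmul_eq_mul]
    field_simp
  rw [hdiff, abs_mul, abs_of_nonneg (by positivity), inv_mul_le_iff₀ (by positivity)]
  refine (Finset.abs_sum_le_sum_abs _ _).trans ((Finset.sum_le_sum fun i _ =>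
    (Finset.abs_sum_le_sum_abs _ _).trans (Finset.sum_le_sum fun j _ => hbd i j)).trans_eq ?_)
  simp only [Finset.sum_add_distrib, Finset.sum_const, Finset.card_univ, Fintype.card_fin,
    nsmul_eq_mul, Finset.sum_ite_eq, Finset.mem_univ, if_true]
  field_simp

variable [CompleteSpace H] [TopologicalSpace.SeparableSpace H]

/-- Oracle inequality in expectation, with an arbitrary competitor `g`. -/
lemma IsPairLoss.integral_popRisk_erm_le (hψ : IsPairLoss ψ K) (P : Measure Z)
    [IsProbabilityMeasure P] (hn : 0 < n) {c : ℝ} (hc : 0 < c) (g : H) :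
    ∫ D : Fin n → Z, popRisk ψ P (erm hψ c D) ∂(Measure.pi fun _ => P) ≤
      popRisk ψ P g + c * ‖g‖ ^ 2 + 10 * K ^ 2 / (n * c) + 2 * K * ‖g‖ / n := by
  borelize H
  set Q := Measure.pi fun _ : Fin n => P
  have hn' : (0 : ℝ) < n := by exact_mod_cast hn
  have hK := hψ.nonneg
  have hB : ∀ D : Fin n → Z, ‖erm hψ c D‖ ≤ K / c := fun D => (isErm_erm hψ hc D).norm_le hψ hc
  have hm := measurable_erm hψ hc (n := n)
  have h1 := hψ.abs_integral_popRisk_sub_empRisk_le P hn hm hB (η := 8 * K / (n * c))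
    (by positivity) fun S D D' hS h => by
      refine ((isErm_erm hψ hc D).norm_sub_le hψ hc (isErm_erm hψ hc D') h).trans ?_
      have : (S.card : ℝ) ≤ 2 := by exact_mod_cast hS
      have h8 : 4 * K * S.card ≤ 8 * K := by nlinarith
      gcongr
  have h2 := hψ.abs_integral_popRisk_sub_empRisk_le P hn (T := fun _ => g) measurable_const
    (fun _ => le_rfl) (η := 0) le_rfl (by simp)
  have hie : ∀ (T : (Fin n → Z) → H) (B : ℝ), Measurable T → (∀ D, ‖T D‖ ≤ B) →
      Integrable (fun D => empRisk ψ D (T D)) Q := fun T B hT hTB =>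
    (integrable_finsetSum _ fun i _ => integrable_finsetSum _ fun j _ =>
      hψ.integrable_comp _ ((measurable_pi_apply i).prodMk (measurable_pi_apply j)) hT
        hTB).const_mul _
  have h3 : ∫ D, empRisk ψ D (erm hψ c D) ∂Q ≤ ∫ D, (empRisk ψ D g + c * ‖g‖ ^ 2) ∂Q := by
    refine integral_mono (hie _ _ hm hB) ((hie (fun _ => g) _ measurable_const
      fun _ => le_rfl).add (integrable_const _)) fun D => ?_
    have := isErm_erm hψ hc D g
    have h4 : 0 ≤ c / 2 * ‖g - erm hψ c D‖ ^ 2 := by positivity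
    have h5 : 0 ≤ c * ‖erm hψ c D‖ ^ 2 := by positivity
    simp only
    linarith
  rw [integral_add (hie (fun _ => g) _ measurable_const fun _ => le_rfl) (integrable_const _)] at h3
  simp only [integral_const, probReal_univ, one_smul, mul_zero, zero_add] at h2 h3
  have h6 := (abs_le.1 h1).2
  have h7 := (abs_le.1 h2).1
  have h8 : K * (8 * K / (n * c)) + 2 * K * (K / c) / n = 10 * K ^ 2 / (n * c) := by
    field_simp
    ring
  linarith

/-- Oracle inequality with high probability: by stability, the risk of the empirical minimizer has
differences bounded by `4 K² / (n c)`. -/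
theorem IsPairLoss.measure_popRisk_erm_ge_le (hψ : IsPairLoss ψ K) (P : Measure Z)
    [IsProbabilityMeasure P] (hn : 0 < n) {c : ℝ} (hc : 0 < c) (g : H) {ε : ℝ} (hε : 0 ≤ ε) :
    (Measure.pi fun _ => P).real {D : Fin n → Z |
      popRisk ψ P g + c * ‖g‖ ^ 2 + 10 * K ^ 2 / (n * c) + 2 * K * ‖g‖ / n + ε ≤
        popRisk ψ P (erm hψ c D)} ≤ Real.exp (-(ε ^ 2 / (32 * K ^ 4) * (c ^ 2 * n))) := by
  borelize H
  have hn' : (0 : ℝ) < n := by exact_mod_cast hn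
  have hK := hψ.nonneg
  obtain ⟨b, hb⟩ : ∃ b : ℝ≥0, (b : ℝ) = 4 * K ^ 2 / (n * c) := ⟨⟨_, by positivity⟩, rfl⟩
  have hF : Measurable fun D : Fin n → Z => popRisk ψ P (erm hψ c D) :=
    (continuous_of_abs_sub_le (hψ.abs_popRisk_sub_le P)).measurable.comp (measurable_erm hψ hc)
  have hsub := hasSubgaussianMGF_of_bounded_differences P (b := b) n
    (fun D => popRisk ψ P (erm hψ c D)) hF (M := K * (K / c))
    (fun D => (hψ.abs_popRisk_le P _).trans
      (mul_le_mul_of_nonneg_left ((isErm_erm hψ hc D).norm_le hψ hc) hK))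
    (fun D D' i h => by
      refine (hψ.abs_popRisk_sub_le P _ _).trans ?_
      have h1 := (isErm_erm hψ hc D).norm_sub_le hψ hc (isErm_erm hψ hc D') (S := {i})
        fun j hj => h j (by simpa using hj)
      refine (mul_le_mul_of_nonneg_left h1 hK).trans_eq ?_
      rw [hb, Finset.card_singleton, Nat.cast_one]
      ring)
  have hle := hψ.integral_popRisk_erm_le P hn hc g
  refine (measureReal_mono ?_).trans ((hsub.measure_ge_le hε).trans_eq ?_)
  · intro D hD
    simp only [Set.mem_ofPred_eq] at hD ⊢
    linarith
  · congr 1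
    rw [NNReal.coe_mul, NNReal.coe_natCast, NNReal.coe_pow, hb]
    rcases hK.eq_or_lt with h | h
    · simp [← h]
    · field_simp
      ring

end Generalization

/-! ### Functions of a reproducing kernel Hilbert space -/

section RKHSFacts

variable {X : Type*} {H : Type*} [NormedAddCommGroup H] [InnerProductSpace ℝ H] [CompleteSpace H]
  [RKHS ℝ H (X × X) ℝ]

lemma HasBoundedKernel.exists_abs_apply_le (hk : HasBoundedKernel (X := X) H) :
    ∃ κ : ℝ, 0 ≤ κ ∧ ∀ (f : H) u, |f u| ≤ κ * ‖f‖ := by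
  obtain ⟨κ, hκ⟩ := hk
  refine ⟨max κ 0, le_max_right _ _, fun f u => ?_⟩
  have h1 : ‖RKHS.kerFun H u (1 : ℝ)‖ = √(realKernel H u u) := by
    have h : realKernel H u u = ‖RKHS.kerFun H u (1 : ℝ)‖ ^ 2 := by
      rw [← real_inner_self_eq_norm_sq, RKHS.kerFun_inner, RKHS.kerFun_apply, realKernel]
      simp
    rw [h, Real.sqrt_sq (norm_nonneg _)]
  have h2 : f u = inner ℝ (RKHS.kerFun H u (1 : ℝ)) f := by
    rw [RKHS.kerFun_inner]; simp
  rw [h2]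
  refine (abs_real_inner_le_norm _ _).trans (mul_le_mul_of_nonneg_right ?_ (norm_nonneg _))
  rw [h1]
  exact (hκ ⟨u, rfl⟩).trans (le_max_left _ _)

lemma HasMeasurableKernel.measurable_coe [MeasurableSpace X]
    (hk : HasMeasurableKernel (X := X) H) (f : H) : Measurable (⇑f : X × X → ℝ) := by
  have hspan : ∀ g ∈ Submodule.span ℝ {RKHS.kerFun H u v | (u : X × X) (v : ℝ)},
      Measurable (⇑g : X × X → ℝ) := by
    intro g hg
    induction hg using Submodule.span_induction with
    | mem g hg =>
      obtain ⟨u, v, rfl⟩ := hg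
      have : (⇑(RKHS.kerFun H u v) : X × X → ℝ) = fun w => v * realKernel H w u := by
        funext w
        rw [RKHS.kerFun_apply, realKernel, ← smul_eq_mul, ← map_smul, smul_eq_mul, mul_one]
      rw [this]
      exact (Measurable.comp hk (measurable_id.prodMk measurable_const)).const_mul v
    | zero => rw [RKHS.coe_zero]; exact measurable_const
    | add g h _ _ hg hh => rw [RKHS.coe_add]; exact hg.add hh
    | smul a g _ hg => rw [RKHS.coe_smul]; exact hg.const_smul a
  have hf : f ∈ closure (Submodule.span ℝ {RKHS.kerFun H u v | (u : X × X) (v : ℝ)} : Set H) := by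
    rw [← Submodule.topologicalClosure_coe, RKHS.kerFun_dense]
    trivial
  obtain ⟨g, hg, hgf⟩ := mem_closure_iff_seq_limit.1 hf
  refine measurable_of_tendsto_metrizable (fun n => hspan (g n) (hg n)) ?_
  rw [tendsto_pi_nhds]
  exact fun u => ((RKHS.continuous_eval u).tendsto f).comp hgf

end RKHSFacts

/-! ### Risks as real integrals -/

section Risk

variable {X : Type*} [MeasurableSpace X] {Y : Set ℝ}

lemma riskPos_ne_top {l : (X × Y) × (X × Y) → ℝ → ℝ} {P : Measure (X × Y)} {f : X × X → ℝ}
    (h : Integrable (fun z => l z (f (z.1.1, z.2.1))) (P.prod P)) : riskPos l P f ≠ ∞ :=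
  (lt_of_le_of_lt (lintegral_mono fun _ => Real.ofReal_le_enorm _) h.2).ne

lemma riskNeg_ne_top {l : (X × Y) × (X × Y) → ℝ → ℝ} {P : Measure (X × Y)} {f : X × X → ℝ}
    (h : Integrable (fun z => l z (f (z.1.1, z.2.1))) (P.prod P)) : riskNeg l P f ≠ ∞ :=
  (lt_of_le_of_lt (lintegral_mono fun _ => Real.ofReal_le_enorm _) h.neg.2).ne

lemma risk_eq_coe_integral {l : (X × Y) × (X × Y) → ℝ → ℝ} {P : Measure (X × Y)} {f : X × X → ℝ}
    (h : Integrable (fun z => l z (f (z.1.1, z.2.1))) (P.prod P)) :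
    risk l P f = ((∫ z, l z (f (z.1.1, z.2.1)) ∂(P.prod P) : ℝ) : EReal) := by
  have key : ∀ a : ℝ≥0∞, a ≠ ∞ → (a : EReal) = ((a.toReal : ℝ) : EReal) := fun a ha => by
    conv_lhs => rw [← ENNReal.ofReal_toReal ha]
    rw [EReal.coe_ennreal_ofReal, max_eq_left ENNReal.toReal_nonneg]
  rw [risk, key _ (riskPos_ne_top h), key _ (riskNeg_ne_top h), ← EReal.coe_sub,
    integral_eq_lintegral_pos_part_sub_lintegral_neg_part h]
  rfl

lemma isProbabilityMeasure_empiricalMeasure {Z : Type*} [MeasurableSpace Z] (D : ℕ → Z) {n : ℕ}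
    (hn : 0 < n) : IsProbabilityMeasure (empiricalMeasure D n) := by
  constructor
  simp only [empiricalMeasure, Measure.smul_apply, Measure.finsetSum_apply, measure_univ,
    Finset.sum_const, Finset.card_range, nsmul_eq_mul, mul_one, smul_eq_mul]
  exact ENNReal.inv_mul_cancel (by exact_mod_cast hn.ne') (ENNReal.natCast_ne_top n)

lemma integral_empiricalMeasure {Z : Type*} [MeasurableSpace Z] (D : ℕ → Z) (n : ℕ) {h : Z → ℝ}
    (hh : Measurable h) :
    ∫ z, h z ∂(empiricalMeasure D n) = (n : ℝ)⁻¹ * ∑ i : Fin n, h (D i) := by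
  rw [empiricalMeasure, integral_smul_measure, integral_finsetSum_measure]
  · simp [integral_dirac' _ _ hh.stronglyMeasurable, Finset.sum_range]
  · exact fun i _ => integrable_dirac' hh.stronglyMeasurable (by simp)

/-- Averaging over the square of the empirical measure is averaging over all `n²` pairs; measurable
singletons are not needed because the integrand is measurable. -/
lemma integral_empiricalMeasure_prod {Z : Type*} [MeasurableSpace Z] (D : ℕ → Z) {n : ℕ}
    (hn : 0 < n) {h : Z × Z → ℝ} (hh : Measurable h)
    (hi : Integrable h ((empiricalMeasure D n).prod (empiricalMeasure D n))) :
    ∫ z, h z ∂((empiricalMeasure D n).prod (empiricalMeasure D n)) =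
      ((n : ℝ) ^ 2)⁻¹ * ∑ i : Fin n, ∑ j : Fin n, h (D i, D j) := by
  have := isProbabilityMeasure_empiricalMeasure D hn
  rw [integral_prod _ hi, integral_empiricalMeasure D n
    (hh.stronglyMeasurable.integral_prod_right' (ν := empiricalMeasure D n)).measurable]
  have h1 : ∀ x, ∫ y, h (x, y) ∂(empiricalMeasure D n) = (n : ℝ)⁻¹ * ∑ j : Fin n, h (x, D j) :=
    fun x => integral_empiricalMeasure D n (hh.comp measurable_prodMk_left)
  simp_rw [h1, ← Finset.mul_sum]
  rw [← mul_assoc, pow_two, mul_inv]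

end Risk

/-! ### The pairwise loss induced on the Hilbert space -/

section Induced

variable {X : Type*} [MeasurableSpace X] {Y : Set ℝ} {L : (X × Y) × (X × Y) → ℝ → ℝ}

/-- The shifted loss as a function of the pair of observations and the predictor in `H`. -/
noncomputable def hilbertLoss {X : Type*} {Y : Set ℝ} (H : Type*) [NormedAddCommGroup H]
    [InnerProductSpace ℝ H] [RKHS ℝ H (X × X) ℝ] (L : (X × Y) × (X × Y) → ℝ → ℝ)
    (z : (X × Y) × (X × Y)) (f : H) : ℝ :=
  shiftedLoss L z (f (z.1.1, z.2.1))

lemma measurable_inputs : Measurable fun z : (X × Y) × (X × Y) => (z.1.1, z.2.1) :=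
  (measurable_fst.comp measurable_fst).prodMk (measurable_fst.comp measurable_snd)

lemma IsPairwiseLoss.measurable_shiftedLoss (hL : IsPairwiseLoss L) {f : X × X → ℝ}
    (hf : Measurable f) :
    Measurable fun z : (X × Y) × (X × Y) => shiftedLoss L z (f (z.1.1, z.2.1)) :=
  (hL.measurable.comp (measurable_id.prodMk (hf.comp measurable_inputs))).sub
    (hL.measurable.comp (measurable_id.prodMk measurable_const))

variable {H : Type*} [NormedAddCommGroup H] [InnerProductSpace ℝ H] [RKHS ℝ H (X × X) ℝ]

lemma exists_isPairLoss_hilbertLoss [CompleteSpace H] (hL : IsPairwiseLoss L) (hconv : IsConvexLoss L)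
    (hlip : IsLipschitzLoss L) (hkb : HasBoundedKernel (X := X) H)
    (hkm : HasMeasurableKernel (X := X) H) :
    ∃ K : ℝ, 0 < K ∧ IsPairLoss (hilbertLoss H L) K := by
  obtain ⟨C, hC⟩ := hlip
  obtain ⟨κ, hκ0, hκ⟩ := hkb.exists_abs_apply_le
  refine ⟨C * κ + 1, by positivity, ⟨fun f => hL.measurable_shiftedLoss (hkm.measurable_coe f),
    fun z => ?_, fun z f g => ?_, fun z => by simp [hilbertLoss, shiftedLoss], by positivity⟩⟩
  · refine ⟨convex_univ, fun f _ g _ a b ha hb hab => ?_⟩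
    have h1 := (hconv z).2 (Set.mem_univ (f (z.1.1, z.2.1))) (Set.mem_univ (g (z.1.1, z.2.1)))
      ha hb hab
    simp only [hilbertLoss, shiftedLoss, RKHS.coe_add, RKHS.coe_smul, Pi.add_apply, Pi.smul_apply,
      smul_eq_mul] at h1 ⊢
    have h2 : L z 0 = a * L z 0 + b * L z 0 := by rw [← add_mul, hab, one_mul]
    linarith
  · have h1 := (hC z).dist_le_mul (f (z.1.1, z.2.1)) (g (z.1.1, z.2.1))
    have h2 := hκ (f - g) (z.1.1, z.2.1)
    rw [Real.dist_eq, Real.dist_eq] at h1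
    rw [RKHS.coe_sub, Pi.sub_apply] at h2
    have h3 : hilbertLoss H L z f - hilbertLoss H L z g =
        L z (f (z.1.1, z.2.1)) - L z (g (z.1.1, z.2.1)) := by
      simp [hilbertLoss, shiftedLoss]
    rw [h3]
    have h4 : (C : ℝ) * |f (z.1.1, z.2.1) - g (z.1.1, z.2.1)| ≤ C * (κ * ‖f - g‖) := by gcongr
    have := norm_nonneg (f - g)
    linarith

lemma IsPairLoss.risk_eq {K : ℝ} (hψ : IsPairLoss (hilbertLoss H L) K) (P : Measure (X × Y))
    [IsProbabilityMeasure P] (f : H) :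
    risk (shiftedLoss L) P f = (popRisk (hilbertLoss H L) P f : EReal) :=
  risk_eq_coe_integral (hψ.integrable (P.prod P) f)

lemma IsPairLoss.regRisk_empiricalMeasure {K : ℝ} (hψ : IsPairLoss (hilbertLoss H L) K)
    (D : ℕ → X × Y) {n : ℕ} (hn : 0 < n) (c : ℝ) (f : H) :
    regRisk (shiftedLoss L) (empiricalMeasure D n) c f =
      ((empRisk (hilbertLoss H L) (fun i : Fin n => D i) f + c * ‖f‖ ^ 2 : ℝ) : EReal) := by
  have := isProbabilityMeasure_empiricalMeasure D hn
  rw [regRisk, hψ.risk_eq, popRisk, integral_empiricalMeasure_prod D hn (hψ.measurable f)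
    (hψ.integrable _ f), EReal.coe_add]
  rfl

lemma IsPairLoss.isRegMinimizer_iff [CompleteSpace H] {K : ℝ}
    (hψ : IsPairLoss (hilbertLoss H L) K) (D : ℕ → X × Y) {n : ℕ} (hn : 0 < n) {c : ℝ} (hc : 0 < c) (f : H) :
    IsRegMinimizer (shiftedLoss L) (empiricalMeasure D n) c f ↔
      f = erm hψ c fun i : Fin n => D i := by
  have herm := isErm_erm hψ hc fun i : Fin n => D i
  simp only [IsRegMinimizer, hψ.regRisk_empiricalMeasure D hn, EReal.coe_le_coe_iff]
  refine ⟨fun h => herm.eq_of_le hc (h _), ?_⟩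
  rintro rfl g
  exact le_trans (le_add_of_nonneg_right (by positivity)) (herm g)

lemma IsPairLoss.regMinimizer_eq [CompleteSpace H] {K : ℝ}
    (hψ : IsPairLoss (hilbertLoss H L) K) (D : ℕ → X × Y) {n : ℕ} (hn : 0 < n) {c : ℝ} (hc : 0 < c) :
    regMinimizer H (shiftedLoss L) (empiricalMeasure D n) c = erm hψ c fun i : Fin n => D i :=
  (hψ.isRegMinimizer_iff D hn hc _).1
    (Classical.epsilon_spec ⟨_, (hψ.isRegMinimizer_iff D hn hc _).2 rfl⟩)

/-! ### The Bayes risk is the infimum of the risk over the Hilbert space -/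

lemma IsPairLoss.bayesRisk_le [CompleteSpace H] {K : ℝ} (hψ : IsPairLoss (hilbertLoss H L) K)
    (hkm : HasMeasurableKernel (X := X) H) (P : Measure (X × Y)) [IsProbabilityMeasure P] (f : H) :
    bayesRisk (shiftedLoss L) P ≤ popRisk (hilbertLoss H L) P f :=
  sInf_le ⟨f, hkm.measurable_coe f, .inl (riskPos_ne_top (hψ.integrable (P.prod P) f)),
    (hψ.risk_eq P f).symm⟩

/-- Truncating a predictor where it exceeds `m` replaces the shifted loss by `0` there, so that the
risks of the truncations eventually fall below any bound on the risk of the predictor, even if the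
latter is `-∞`. -/
lemma exists_bounded_risk_lt (hL : IsPairwiseLoss L) {P : Measure (X × Y)} {f : X × X → ℝ}
    (hf : Measurable f) (hex : RiskExists (shiftedLoss L) P f) {c : EReal}
    (hc : risk (shiftedLoss L) P f < c) :
    ∃ g : X × X → ℝ, Measurable g ∧ (∃ M : ℝ, ∀ u, |g u| ≤ M) ∧ risk (shiftedLoss L) P g < c := by
  set l := shiftedLoss L with hl
  have hl0 : ∀ z, l z 0 = 0 := fun z => by simp [hl, shiftedLoss]
  have hpos : riskPos l P f ≠ ∞ := by
    intro h
    have h' : riskNeg l P f ≠ ∞ := hex.resolve_left (not_not.2 h)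
    rw [risk, h, EReal.coe_ennreal_top, EReal.top_sub (by simpa using h')] at hc
    exact not_top_lt hc
  set A : ℕ → Set (X × X) := fun m => {u | |f u| ≤ m} with hA
  have hAm : ∀ m, MeasurableSet (A m) := fun m => measurableSet_le hf.abs measurable_const
  set g : ℕ → X × X → ℝ := fun m => (A m).indicator f with hg
  have hgm : ∀ m, Measurable (g m) := fun m => hf.indicator (hAm m)
  have hgl : ∀ m z, l z (g m (z.1.1, z.2.1)) =
      if |f (z.1.1, z.2.1)| ≤ m then l z (f (z.1.1, z.2.1)) else 0 := by
    intro m z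
    by_cases h : |f (z.1.1, z.2.1)| ≤ m
    · simp [hg, hA, h]
    · simp [hg, hA, h, hl0]
  have hposle : ∀ m, riskPos l P (g m) ≤ riskPos l P f := fun m => lintegral_mono fun z => by
    rw [hgl]
    split_ifs <;> simp
  have hneglim : Tendsto (fun m => riskNeg l P (g m)) atTop (𝓝 (riskNeg l P f)) := by
    refine lintegral_tendsto_of_tendsto_of_monotone (fun m =>
      (hL.measurable_shiftedLoss (hgm m)).neg.ennreal_ofReal.aemeasurable)
      (Eventually.of_forall fun z m m' hmm' => ?_) (Eventually.of_forall fun z => ?_)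
    · simp only [hgl]
      by_cases h : |f (z.1.1, z.2.1)| ≤ m
      · have h' : |f (z.1.1, z.2.1)| ≤ m' := h.trans (by exact_mod_cast hmm')
        simp [h, h']
      · simp [h]
    · refine tendsto_const_nhds.congr' ?_
      obtain ⟨N, hN⟩ := exists_nat_ge |f (z.1.1, z.2.1)|
      filter_upwards [eventually_ge_atTop N] with m hm
      rw [hgl, if_pos (hN.trans (by exact_mod_cast hm))]
  have hlim : Tendsto (fun m => (riskPos l P f : EReal) - (riskNeg l P (g m) : EReal)) atTop
      (𝓝 (risk l P f)) := by
    have h1 : Tendsto (fun m => -(riskNeg l P (g m) : EReal)) atTop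
        (𝓝 (-(riskNeg l P f : EReal))) :=
      (continuous_neg.tendsto _).comp ((continuous_coe_ennreal_ereal.tendsto _).comp hneglim)
    exact (EReal.continuousAt_add (.inl (mt EReal.coe_ennreal_eq_top_iff.1 hpos))
      (.inl (EReal.coe_ennreal_ne_bot _))).tendsto.comp
      (tendsto_const_nhds.prodMk_nhds h1)
  obtain ⟨m, hm⟩ := (hlim.eventually_lt_const hc).exists
  refine ⟨g m, hgm m, ⟨m, fun u => ?_⟩, lt_of_le_of_lt ?_ hm⟩
  · by_cases h : |f u| ≤ m
    · simp [hg, hA, h]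
    · simp [hg, hA, h]
  · exact EReal.sub_le_sub (by exact_mod_cast hposle m) le_rfl

lemma IsPairLoss.exists_popRisk_lt {K : ℝ} (hψ : IsPairLoss (hilbertLoss H L) K)
    (hL : IsPairwiseLoss L) (hlip : IsLipschitzLoss L) (hdense : IsDenseInAllL1 (X := X) H)
    (P : Measure (X × Y)) [IsProbabilityMeasure P] {c : EReal}
    (hc : bayesRisk (shiftedLoss L) P < c) :
    ∃ h : H, (popRisk (hilbertLoss H L) P h : EReal) < c := by
  obtain ⟨_, ⟨f, hf, hex, rfl⟩, hfc⟩ := sInf_lt_iff.1 hc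
  obtain ⟨g, hg, ⟨M, hM⟩, hgc⟩ := exists_bounded_risk_lt hL hf hex hfc
  obtain ⟨C, hC⟩ := hlip
  have hlipl : ∀ z s t, |shiftedLoss L z s - shiftedLoss L z t| ≤ C * |s - t| := fun z s t => by
    have := (hC z).dist_le_mul s t
    simpa [Real.dist_eq, shiftedLoss] using this
  set u : (X × Y) × (X × Y) → X × X := fun z => (z.1.1, z.2.1) with hu
  have hum : Measurable u := measurable_inputs
  set ν := (P.prod P).map u with hν
  have hνp : IsProbabilityMeasure ν := Measure.isProbabilityMeasure_map hum.aemeasurable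
  have hgi : Integrable g ν :=
    Integrable.of_bound hg.aestronglyMeasurable M (Eventually.of_forall hM)
  have hgl : Integrable (fun z => shiftedLoss L z (g (u z))) (P.prod P) := by
    refine Integrable.of_bound (hL.measurable_shiftedLoss hg).aestronglyMeasurable (C * M)
      (Eventually.of_forall fun z => ?_)
    have h1 := hlipl z (g (u z)) 0
    have h2 : shiftedLoss L z 0 = 0 := by simp [shiftedLoss]
    rw [h2, sub_zero, sub_zero] at h1
    exact h1.trans (mul_le_mul_of_nonneg_left (hM _) C.2)
  rw [risk_eq_coe_integral hgl] at hgc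
  obtain ⟨r, hr1, hr2⟩ := EReal.lt_iff_exists_real_btwn.1 hgc
  have hr1' := EReal.coe_lt_coe_iff.1 hr1
  set a := ∫ z, shiftedLoss L z (g (u z)) ∂(P.prod P) with ha
  obtain ⟨h, hh⟩ := (hdense ν hνp).2 g hgi ((r - a) / (C + 1))
    (div_pos (sub_pos.2 hr1') (by positivity))
  refine ⟨h, lt_of_le_of_lt (EReal.coe_le_coe_iff.2 ?_) hr2⟩
  have hhi : Integrable (fun v => |h v - g v|) ν := (((hdense ν hνp).1 h).sub hgi).abs
  have hhi' : Integrable (fun z => |h (u z) - g (u z)|) (P.prod P) :=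
    hhi.comp_measurable hum
  have hmap : ∫ z, |h (u z) - g (u z)| ∂(P.prod P) = ∫ v, |h v - g v| ∂ν :=
    (integral_map hum.aemeasurable hhi.aestronglyMeasurable).symm
  have hdiff : popRisk (hilbertLoss H L) P h - a ≤ C * ∫ v, |h v - g v| ∂ν := by
    rw [popRisk, ha, ← integral_sub (hψ.integrable _ h) hgl, ← hmap, ← integral_const_mul]
    exact integral_mono ((hψ.integrable _ h).sub hgl) (hhi'.const_mul _) fun z =>
      (le_abs_self _).trans (hlipl z _ _)
  have h0 : 0 ≤ ∫ v, |h v - g v| ∂ν := integral_nonneg fun _ => abs_nonneg _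
  rw [lt_div_iff₀ (by positivity)] at hh
  have hC0 : (0 : ℝ) ≤ C := C.2
  linarith

end Induced

/-! ### Rates of the regularization parameters -/

lemma tendsto_mul_of_tendsto_sq_mul {lam : ℕ → ℝ} (hpos : ∀ n, 0 < lam n)
    (hlam : Tendsto lam atTop (𝓝 0)) (h : Tendsto (fun n : ℕ => lam n ^ 2 * (n : ℝ)) atTop atTop) :
    Tendsto (fun n : ℕ => (n : ℝ) * lam n) atTop atTop := by
  refine tendsto_atTop_mono' _ ?_ h
  filter_upwards [hlam.eventually_le_const one_pos] with n hn
  have := hpos n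
  have h0 : (0 : ℝ) ≤ n * lam n := by positivity
  nlinarith

lemma tendsto_sq_mul_of_tendsto_rpow_mul {lam : ℕ → ℝ} (hpos : ∀ n, 0 < lam n)
    (hlam : Tendsto lam atTop (𝓝 0)) {δ : ℝ} (hδ : 0 < δ)
    (h : Tendsto (fun n : ℕ => lam n ^ (2 + δ) * (n : ℝ)) atTop atTop) :
    Tendsto (fun n : ℕ => lam n ^ 2 * (n : ℝ)) atTop atTop := by
  refine tendsto_atTop_mono' _ ?_ h
  filter_upwards [hlam.eventually_le_const one_pos] with n hn
  gcongr
  rw [← Real.rpow_natCast]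
  exact Real.rpow_le_rpow_of_exponent_ge (hpos n) hn (by push_cast; linarith)

/-- With `x = λₙ² n`, the growth of `λₙ^(2+δ) n` gives `x ^ ((2 + δ) / 2) ≥ n ^ (δ / 2)`, so
`exp (-a x)` decays faster than any power of `n`. -/
lemma summable_exp_neg_of_tendsto_rpow_mul {lam : ℕ → ℝ} (hpos : ∀ n, 0 < lam n)
    (hlam : Tendsto lam atTop (𝓝 0)) {δ : ℝ} (hδ : 0 < δ)
    (h : Tendsto (fun n : ℕ => lam n ^ (2 + δ) * (n : ℝ)) atTop atTop) {a : ℝ} (ha : 0 < a) :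
    Summable fun n : ℕ => Real.exp (-(a * (lam n ^ 2 * n))) := by
  set m : ℝ := (2 + δ) / 2 * (4 / δ) with hm
  have h1 := (isLittleO_exp_neg_mul_rpow_atTop ha (-m)).comp_tendsto
    (tendsto_sq_mul_of_tendsto_rpow_mul hpos hlam hδ h)
  refine summable_of_isBigO_nat (Real.summable_nat_pow_inv.2 (by norm_num : 1 < 2)) ?_
  have h2 : (fun n : ℕ => (lam n ^ 2 * (n : ℝ)) ^ (-m)) =O[atTop]
      fun n : ℕ => ((n : ℝ) ^ 2)⁻¹ := by
    refine Asymptotics.IsBigO.of_bound 1 ?_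
    filter_upwards [h.eventually_ge_atTop 1, eventually_gt_atTop 0] with n hn hn0
    have hn' : (0 : ℝ) < n := by exact_mod_cast hn0
    have hl := hpos n
    rw [one_mul, Real.norm_of_nonneg (by positivity), Real.norm_of_nonneg (by positivity),
      Real.rpow_neg (by positivity)]
    refine inv_anti₀ (by positivity) ?_
    have h3 : (lam n ^ 2 * (n : ℝ)) ^ ((2 + δ) / 2) =
        (lam n ^ (2 + δ) * n) * (n : ℝ) ^ (δ / 2) := by
      rw [Real.mul_rpow (by positivity) hn'.le, ← Real.rpow_natCast, ← Real.rpow_mul hl.le,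
        mul_assoc, ← Real.rpow_one_add' hn'.le (by positivity)]
      congr 2
      · push_cast; ring
      · ring
    rw [hm, Real.rpow_mul (by positivity), h3]
    have h4 : (n : ℝ) ^ 2 = ((n : ℝ) ^ (δ / 2)) ^ (4 / δ) := by
      rw [← Real.rpow_mul hn'.le, ← Real.rpow_natCast]
      congr 1
      push_cast
      field_simp
      norm_num
    rw [h4]
    refine Real.rpow_le_rpow (by positivity) ?_ (by positivity)
    exact le_mul_of_one_le_left (by positivity) hn
  refine (Asymptotics.IsBigO.trans ?_ (h1.isBigO.trans h2))
  simp only [Function.comp_def, neg_mul]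
  exact Asymptotics.isBigO_refl _ _

/-! ### Consistency -/

/-- The law of a sample of `n` independent observations; the bound on the preimage needs no
measurability of `A`. -/
lemma measureReal_sample_preimage_le {Z Ω : Type*} [MeasurableSpace Z] [MeasurableSpace Ω]
    {P : Measure Z} [IsProbabilityMeasure P] {μ : Measure Ω} [IsProbabilityMeasure μ]
    {W : ℕ → Ω → Z} (hW : ∀ i, Measurable (W i)) (hind : iIndepFun W μ)
    (hlaw : ∀ i, μ.map (W i) = P) (n : ℕ) (A : Set (Fin n → Z)) :
    μ.real {ω | (fun i : Fin n => W i ω) ∈ A} ≤ (Measure.pi fun _ => P).real A := by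
  have hm : Measurable fun ω => fun i : Fin n => W i ω :=
    measurable_pi_lambda _ fun i => hW i
  have hmap : μ.map (fun ω => fun i : Fin n => W i ω) = Measure.pi fun _ => P := by
    rw [(iIndepFun_iff_map_fun_eq_pi_map fun i : Fin n => (hW i).aemeasurable).1
      (hind.precomp Fin.val_injective)]
    simp_rw [hlaw]
  refine ENNReal.toReal_mono (measure_ne_top _ _) ?_
  rw [← hmap]
  exact Measure.le_map_apply hm.aemeasurable A

/-- Above any level `c` exceeding the Bayes risk, the risk of the empirical minimizer has
exponentially small tails. -/
lemma IsPairLoss.exists_measure_risk_ge_le {X : Type*} [MeasurableSpace X] {Y : Set ℝ}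
    {L : (X × Y) × (X × Y) → ℝ → ℝ} {H : Type*} [NormedAddCommGroup H] [InnerProductSpace ℝ H]
    [CompleteSpace H] [TopologicalSpace.SeparableSpace H] [RKHS ℝ H (X × X) ℝ] {K : ℝ}
    (hψ : IsPairLoss (hilbertLoss H L) K) (hK : 0 < K) (hL : IsPairwiseLoss L)
    (hlip : IsLipschitzLoss L) (hdense : IsDenseInAllL1 (X := X) H) {lam : ℕ → ℝ}
    (hpos : ∀ n, 0 < lam n) (hlam : Tendsto lam atTop (𝓝 0))
    (hrate : Tendsto (fun n : ℕ => lam n ^ 2 * (n : ℝ)) atTop atTop) (P : Measure (X × Y))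
    [IsProbabilityMeasure P] {Ω : Type*} [MeasurableSpace Ω] (μ : Measure Ω)
    [IsProbabilityMeasure μ] {W : ℕ → Ω → X × Y} (hW : ∀ i, Measurable (W i))
    (hind : iIndepFun W μ) (hlaw : ∀ i, μ.map (W i) = P) {c : EReal}
    (hc : bayesRisk (shiftedLoss L) P < c) :
    ∃ a : ℝ, 0 < a ∧ ∀ᶠ n : ℕ in atTop,
      μ.real {ω | c ≤ risk (shiftedLoss L) P (regMinimizer H (shiftedLoss L)
        (empiricalMeasure (fun i => W i ω) n) (lam n))} ≤
      Real.exp (-(a * (lam n ^ 2 * n))) := by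
  obtain ⟨g, hg⟩ := hψ.exists_popRisk_lt hL hlip hdense P hc
  obtain ⟨r, hr1, hr2⟩ := EReal.lt_iff_exists_real_btwn.1 hg
  have hr1' := EReal.coe_lt_coe_iff.1 hr1
  set ε := (r - popRisk (hilbertLoss H L) P g) / 2 with hε
  have hε0 : 0 < ε := by simp only [hε]; linarith
  -- All error terms of the oracle inequality vanish as `n → ∞`.
  have hlim : Tendsto (fun n : ℕ => lam n * ‖g‖ ^ 2 + 10 * K ^ 2 / (n * lam n) +
      2 * K * ‖g‖ / n) atTop (𝓝 0) := by
    have h1 : Tendsto (fun n : ℕ => lam n * ‖g‖ ^ 2) atTop (𝓝 0) := by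
      simpa using hlam.mul_const (‖g‖ ^ 2)
    have h2 := (tendsto_mul_of_tendsto_sq_mul hpos hlam hrate).const_div_atTop (10 * K ^ 2)
    have h3 := (tendsto_natCast_atTop_atTop (R := ℝ)).const_div_atTop (2 * K * ‖g‖)
    simpa using (h1.add h2).add h3
  refine ⟨ε ^ 2 / (32 * K ^ 4), by positivity, ?_⟩
  filter_upwards [hlim.eventually_le_const hε0, eventually_gt_atTop 0] with n hn hn0
  refine le_trans (measureReal_mono ?_) ((measureReal_sample_preimage_le hW hind hlaw n _).trans
    (hψ.measure_popRisk_erm_ge_le P hn0 (hpos n) g hε0.le))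
  intro ω hω
  simp only [Set.mem_ofPred_eq] at hω ⊢
  rw [hψ.regMinimizer_eq _ hn0 (hpos n), hψ.risk_eq] at hω
  have h1 := EReal.coe_lt_coe_iff.1 (hr2.trans_le hω)
  have h2 : r = popRisk (hilbertLoss H L) P g + 2 * ε := by simp only [hε]; ring
  linarith

end PairwiseLearning

theorem mainTheorem2 {X : Type*} [MeasurableSpace X] {Y : Set ℝ} (hY : IsClosed Y)
    (L : (X × Y) × (X × Y) → ℝ → ℝ)
    (hL : PairwiseLearning.IsPairwiseLoss L)
    (hL_convex : PairwiseLearning.IsConvexLoss L)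
    (hL_lip : PairwiseLearning.IsLipschitzLoss L)
    {H : Type*} [NormedAddCommGroup H] [InnerProductSpace ℝ H] [CompleteSpace H]
    [TopologicalSpace.SeparableSpace H] [RKHS ℝ H (X × X) ℝ]
    (hk_bdd : PairwiseLearning.HasBoundedKernel (X := X) H)
    (hk_meas : PairwiseLearning.HasMeasurableKernel (X := X) H)
    (hH_dense : PairwiseLearning.IsDenseInAllL1 (X := X) H)
    (lam : ℕ → ℝ) (hlam_pos : ∀ n, 0 < lam n) (hlam : Tendsto lam atTop (𝓝 0)) :
    -- the empirical minimizers exist and are unique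
    (∀ n : ℕ, 1 ≤ n → ∀ D : ℕ → X × Y, ∃! f : H,
      PairwiseLearning.IsRegMinimizer (PairwiseLearning.shiftedLoss L)
        (PairwiseLearning.empiricalMeasure D n) (lam n) f) ∧
    -- (i) convergence in probability
    (Tendsto (fun n : ℕ => lam n ^ 2 * (n : ℝ)) atTop atTop →
      ∀ (P : Measure (X × Y)) [IsProbabilityMeasure P]
        {Ω : Type*} [MeasurableSpace Ω] (μ : Measure Ω) [IsProbabilityMeasure μ]
        (Z : ℕ → Ω → X × Y), (∀ i, Measurable (Z i)) → iIndepFun Z μ → (∀ i, μ.map (Z i) = P) →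
        PairwiseLearning.ConvergesInProbability μ
          (fun n ω => PairwiseLearning.risk (PairwiseLearning.shiftedLoss L) P
            (PairwiseLearning.regMinimizer H (PairwiseLearning.shiftedLoss L)
              (PairwiseLearning.empiricalMeasure (fun i => Z i ω) n) (lam n)))
          (PairwiseLearning.bayesRisk (PairwiseLearning.shiftedLoss L) P)) ∧
    -- (ii) almost sure convergence
    (∀ δ : ℝ, 0 < δ → Tendsto (fun n : ℕ => lam n ^ (2 + δ) * (n : ℝ)) atTop atTop →
      ∀ (P : Measure (X × Y)) [IsProbabilityMeasure P]
        {Ω : Type*} [MeasurableSpace Ω] (μ : Measure Ω) [IsProbabilityMeasure μ]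
        (Z : ℕ → Ω → X × Y), (∀ i, Measurable (Z i)) → iIndepFun Z μ → (∀ i, μ.map (Z i) = P) →
        ∀ᵐ ω ∂μ, Tendsto
          (fun n => PairwiseLearning.risk (PairwiseLearning.shiftedLoss L) P
            (PairwiseLearning.regMinimizer H (PairwiseLearning.shiftedLoss L)
              (PairwiseLearning.empiricalMeasure (fun i => Z i ω) n) (lam n)))
          atTop (𝓝 (PairwiseLearning.bayesRisk (PairwiseLearning.shiftedLoss L) P))) := by
  obtain ⟨K, hK, hψ⟩ :=
    PairwiseLearning.exists_isPairLoss_hilbertLoss hL hL_convex hL_lip hk_bdd hk_meas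
  have hge : ∀ (P : Measure (X × Y)) [IsProbabilityMeasure P] (f : H),
      PairwiseLearning.bayesRisk (PairwiseLearning.shiftedLoss L) P ≤
        PairwiseLearning.risk (PairwiseLearning.shiftedLoss L) P f := fun P _ f => by
    rw [hψ.risk_eq]; exact hψ.bayesRisk_le hk_meas P f
  have htop : ∀ (P : Measure (X × Y)) [IsProbabilityMeasure P],
      PairwiseLearning.bayesRisk (PairwiseLearning.shiftedLoss L) P < ⊤ := fun P _ =>
    (hψ.bayesRisk_le hk_meas P 0).trans_lt (EReal.coe_lt_top _)
  refine ⟨fun n hn D => ?_, fun hrate P _ Ω _ μ _ Z hZ hind hlaw => ?_,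
    fun δ hδ hrate P _ Ω _ μ _ Z hZ hind hlaw => ?_⟩
  · exact ⟨_, (hψ.isRegMinimizer_iff D hn (hlam_pos n) _).2 rfl,
      fun f hf => (hψ.isRegMinimizer_iff D hn (hlam_pos n) f).1 hf⟩
  · intro U hU
    obtain ⟨c, hc, hcU⟩ := exists_Ico_subset_of_mem_nhds hU ⟨⊤, htop P⟩
    obtain ⟨a, ha, hbound⟩ := hψ.exists_measure_risk_ge_le hK hL hL_lip hH_dense hlam_pos hlam
      hrate P μ hZ hind hlaw hc
    have hexp : Tendsto (fun n : ℕ => ENNReal.ofReal (Real.exp (-(a * (lam n ^ 2 * n))))) atTop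
        (𝓝 0) := by
      rw [← ENNReal.ofReal_zero]
      exact ENNReal.tendsto_ofReal (Real.tendsto_exp_neg_atTop_nhds_zero.comp
        (hrate.const_mul_atTop ha))
    refine tendsto_of_tendsto_of_tendsto_of_le_of_le' tendsto_const_nhds hexp
      (Eventually.of_forall fun _ => zero_le) ?_
    filter_upwards [hbound] with n hn
    refine (measure_mono fun ω hω => ?_).trans
      ((ENNReal.le_ofReal_iff_toReal_le (measure_ne_top _ _) (Real.exp_pos _).le).2 hn)
    -- Off the event `{c ≤ risk}` the risk lies in `[R*, c) ⊆ U`.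
    by_contra h
    exact hω (hcU ⟨hge P _, not_le.1 h⟩)
  · have hrate' := PairwiseLearning.tendsto_sq_mul_of_tendsto_rpow_mul hlam_pos hlam hδ hrate
    -- It suffices to go below countably many levels `c k` decreasing to the Bayes risk `R*`.
    obtain ⟨c, -, hc, hclim⟩ := exists_seq_strictAnti_tendsto' (htop P)
    have hev : ∀ k, ∀ᵐ ω ∂μ, ∀ᶠ n in atTop,
        PairwiseLearning.risk (PairwiseLearning.shiftedLoss L) P
          (PairwiseLearning.regMinimizer H (PairwiseLearning.shiftedLoss L)
            (PairwiseLearning.empiricalMeasure (fun i => Z i ω) n) (lam n)) < c k := by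
      intro k
      obtain ⟨a, ha, hbound⟩ := hψ.exists_measure_risk_ge_le hK hL hL_lip hH_dense hlam_pos hlam
        hrate' P μ hZ hind hlaw (hc k).1
      have hsum := summable_of_isBigO_nat
        (PairwiseLearning.summable_exp_neg_of_tendsto_rpow_mul hlam_pos hlam hδ hrate ha)
        (Asymptotics.IsBigO.of_bound 1 (hbound.mono fun n hn => by
          rwa [one_mul, Real.norm_of_nonneg measureReal_nonneg,
            Real.norm_of_nonneg (Real.exp_pos _).le]))
      have hne := hsum.tsum_ofReal_ne_top
      simp only [measureReal_def, ENNReal.ofReal_toReal (measure_ne_top μ _)] at hne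
      filter_upwards [ae_eventually_notMem hne] with ω hω
      filter_upwards [hω] with n hn
      exact not_le.1 hn
    filter_upwards [ae_all_iff.2 hev] with ω hω
    refine tendsto_order.2 ⟨fun b hb => Eventually.of_forall fun n => hb.trans_le (hge P _),
      fun b hb => ?_⟩
    obtain ⟨k, hk⟩ := (hclim.eventually_lt_const hb).exists
    filter_upwards [hω k] with n hn
    exact hn.trans hk
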